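/- Let $d\in\mathbb N=\{1,2,\dots\}$, $0<s<\infty$ and $0<r\le\infty$. Let $\mathbb T=\mathbb R/\mathbb Z$, equip $\mathbb T^d$ with its normalized Haar measure, put $e_k(x)=e^{2\pi i k\cdot x}$ and $\hat f(k)=\int_{\mathbb T^d}f(x)\overline{e_k(x)}\,dx$ for $k\in\mathbb Z^d$ and $f\in L_1(\mathbb T^d)$, and let $\mathcal T^d=\{e_k:k\in\mathbb Z^d\}$ be the trigonometric system. (The period is only a normalization: rescaling $x\mapsto 2\pi x$ gives the torus $[0,2\pi]^d$ with the measure $(2\pi)^{-d}dx$ and the functions $e^{ik\cdot x}$.) Put $$\omega_{s,r}(k)=\prod_{i=1}^d(1+|k_i|^r)^{s/r}\quad(0<r<\infty),\qquad \omega_{s,\infty}(k)=\prod_{i=1}^d\max(1,|k_i|)^s .$$ Let $H^{s,r}_{\rm mix}(\mathbb T^d)$ be the space of all $f\in L_1(\mathbb T^d)$ with $\|f\|_{H^{s,r}_{\rm mix}}=\big(\sum_{k\in\mathbb Z^d}|\omega_{s,r}(k)\hat f(k)|^2\big)^{1/2}<\infty$, and let $\mathcal A(\mathbb T^d)$ be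 the Wiener algebra of all $f\in L_1(\mathbb T^d)$ with $\|f\|_{\mathcal A}=\sum_{k\in\mathbb Z^d}|\hat f(k)|<\infty$. For $Y=L_2(\mathbb T^d)$ or $Y=\mathcal A(\mathbb T^d)$, the best $n$-term trigonometric width is $$\sigma_n\big(id:H^{s,r}_{\rm mix}(\mathbb T^d)\to Y,\mathcal T^d\big)=\sup_{\|f\|_{H^{s,r}_{\rm mix}}\le1}\ \inf_{\substack{a_1,\dots,a_n\in\mathbb C\\ y_1,\dots,y_n\in\mathcal T^d}}\Big\|f-\sum_{j=1}^n a_jy_j\Big\|_Y .$$ Then all the widths $\sigma_n\big(id:H^{s,r}_{\rm mix}(\mathbb T^d)\to L_2(\mathbb T^d),\mathcal T^d\big)$ are finite and $$\lim_{n\to\infty}\frac{\sigma_n\big(id:H^{s,r}_{\rm mix}(\mathbb T^d)\to L_2(\mathbb T^d),\mathcal T^d\big)}{n^{-s}(\ln n)^{s(d-1)}}=\frac{s^s}{(s+\frac12)^s}\Big(\frac{2^d}{(d-1)!}\Big)^s .$$ If moreover $s>\frac12$, then all the widths $\sigma_n\big(id:H^{s,r}_{\rm mix}(\mathbb T^d)\to\mathcal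 A(\mathbb T^d),\mathcal T^d\big)$ are finite and $$\lim_{n\to\infty}\frac{\sigma_n\big(id:H^{s,r}_{\rm mix}(\mathbb T^d)\to\mathcal A(\mathbb T^d),\mathcal T^d\big)}{n^{-s+\frac12}(\ln n)^{s(d-1)}}=\Big(\frac{s}{s+\frac12}\Big)^s\Big(\frac1{s-\frac12}\Big)^{\frac12}\Big(\frac{2^d}{(d-1)!}\Big)^s .$$ -/

import Mathlib

open MeasureTheory Filter Topology
open scoped ENNReal Nat

noncomputable section

namespace TrigWidth

/-! ### Best `n`-term approximation widths -/

/-- The error of the best approximation of `y` by linear combinations of `n` elements of the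
dictionary `D` (complex coefficients, repetitions allowed), measured in the extended
(quasi-)norm `N`; here `N` takes the value `∞` outside of the space that it defines. -/
def nTermError {V : Type*} [AddCommGroup V] [Module ℂ V] (N : V → ℝ≥0∞) (D : Set V) (n : ℕ)
    (y : V) : ℝ≥0∞ :=
  ⨅ (a : Fin n → ℂ) (e : Fin n → D), N (y - ∑ j, a j • (e j : V))

/-- The best `n`-term approximation width with respect to `D` of the identity from the space with
extended (quasi-)norm `NX` into the space with extended (quasi-)norm `NY`: the supremum of the
`n`-term errors over the closed unit ball of the first space. -/
def nTermWidth {V : Type*} [AddCommGroup V] [Module ℂ V] (NX NY : V → ℝ≥0∞) (D : Set V)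
    (n : ℕ) : ℝ≥0∞ :=
  ⨆ (x : V) (_ : NX x ≤ 1), nTermError NY D n x

/-! ### Function spaces on the torus -/

/-- The normalized (probability) Haar measure on the `d`-dimensional torus `(ℝ / ℤ) ^ d`. -/
abbrev torusMeasure (d : ℕ) : Measure (UnitAddTorus (Fin d)) :=
  Measure.pi fun _ => AddCircle.haarAddCircle

/-- The space `L₁` of the torus, in which all the function classes below are contained. -/
abbrev L1Torus (d : ℕ) : Type := Lp ℂ 1 (torusMeasure d)

/-- The trigonometric system `{e_k : k ∈ ℤ ^ d}`, where `e_k x = ∏ j, exp (2 π i k_j x_j)`. -/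
def trigSystem (d : ℕ) : Set (L1Torus d) :=
  Set.range fun k : Fin d → ℤ =>
    ContinuousMap.toLp (E := ℂ) 1 (torusMeasure d) ℂ (UnitAddTorus.mFourier k)

/-- For a weight `ω` on `ℤ ^ d` and `0 < p < ∞`, the quasi-norm
`(∑ k, |ω k * fourierCoeff f k| ^ p) ^ (1 / p)` of the class `F_{ω,p}`. The class consists of the
`f` in `L₁` for which it is finite. -/
def weightedNorm {d : ℕ} (ω : (Fin d → ℤ) → ℝ) (p : ℝ) (f : L1Torus d) : ℝ≥0∞ :=
  (∑' k : Fin d → ℤ, ‖(ω k : ℂ) * UnitAddTorus.mFourierCoeff f k‖ₑ ^ p) ^ (1 / p)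

/-- The weight of mixed smoothness `s` with fine parameter `0 < r ≤ ∞`. -/
def mixWeight {d : ℕ} (s : ℝ) (r : ℝ≥0∞) (k : Fin d → ℤ) : ℝ :=
  if r = ∞ then ∏ i, (max 1 |(k i : ℝ)|) ^ s
  else ∏ i, (1 + |(k i : ℝ)| ^ r.toReal) ^ (s / r.toReal)

/-- The norm of the Sobolev space `H^{s,r}_mix` of mixed smoothness, which is `F_{ω,2}` for the
weight `ω = mixWeight s r`. -/
def sobolevMixNorm {d : ℕ} (s : ℝ) (r : ℝ≥0∞) (f : L1Torus d) : ℝ≥0∞ :=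
  weightedNorm (mixWeight s r) 2 f

/-- The norm of `L₂` of the torus. -/
def l2Norm {d : ℕ} (f : L1Torus d) : ℝ≥0∞ := eLpNorm f 2 (torusMeasure d)

/-- The norm of the Wiener algebra: the sum of the absolute values of the Fourier
coefficients. -/
def wienerNorm {d : ℕ} (f : L1Torus d) : ℝ≥0∞ := weightedNorm (fun _ => 1) 1 f

end TrigWidth

end

/-!
The torus functions enter only through their Fourier coefficients. Two functions in `L₁` with equal
coefficients agree (`eq_zero_of_coeffL_eq_zero`), so Parseval's identity holds on all of `L₁`
(`tsum_coeff_sq`), and the problem is to bound the `ℓ_p` norm, for `p = 2` or `p = 1`, of a family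
`c` after removal of its `n` largest members, subject to `∑ (ω k * c k) ^ 2 ≤ 1`.

This extremal problem is solved by a Lagrange multiplier. For a threshold `T` put
`clip (ω k / T) = min 1 ((ω k / T) ^ 2)`. Cutting `c` off at the height `τ` of the largest member
that is not removed gives a family `x` for which the error is `∑ x k ^ p - n * τ ^ p`. If the
numbers `1 - clip (ω k / T)` add up to at most `n`, this is bounded by
`∑ x k ^ p * clip (ω k / T)`, so the width is at most `1 / T` for `p = 2`, and by the Cauchy-Schwarz
inequality at most the root of `∑ (clip (ω k / T) / ω k) ^ 2` for `p = 1`. If the numbers add up to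
at least `n`, explicit extremal functions give the reverse inequalities
(`l2_width_le`, `le_l2_width`, `wiener_width_le`, `le_wiener_width`). No rearrangement of the weight
is needed, and the widths are known as soon as these two sums are known asymptotically.

The weight is `ω k = v k ^ s` with `v k = ∏ i, w (k i)`, where `w` has about `2 * t` values below
`t`. Summing over one variable at a time, `v` has about `C * t * log t ^ (d - 1)` values below `t`,
where `C = 2 ^ d / (d - 1)!` (`tendsto_count_prod_fin`). With `T = R ^ s`, summation by parts turns
both sums into integrals of the counting function against powers, and these are asymptotic to
multiples of `R * log R ^ (d - 1)` and `R ^ (1 - 2 * s) * log R ^ (d - 1)`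
(`tendsto_cutSum`, `exists_hasSum_clip_div_sq`).
The first relation is inverted by taking `R = y * n / log n ^ (d - 1)`: the first sum is then about
`C * s / (s + 1 / 2) * y * n`, and letting `y` tend to the critical value from both sides gives the
limits.
-/

namespace TrigWidth

/-! ### Fourier coefficients of integrable functions on the torus -/

open UnitAddTorus

/-- The exponential `e_k` as an element of `L₁` of the torus. -/
noncomputable def trigFun {d : ℕ} (k : Fin d → ℤ) : L1Torus d :=
  ContinuousMap.toLp (E := ℂ) 1 (torusMeasure d) ℂ (mFourier k)

lemma coeFn_trigFun {d : ℕ} (k : Fin d → ℤ) : trigFun k =ᵐ[torusMeasure d] mFourier k :=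
  ContinuousMap.coeFn_toLp (torusMeasure d) (mFourier k)

lemma mFourierCoeff_def {d : ℕ} (f : UnitAddTorus (Fin d) → ℂ) (k : Fin d → ℤ) :
    mFourierCoeff f k = ∫ t, mFourier (-k) t * f t ∂(torusMeasure d) := rfl

lemma integrable_continuousMap_mul {d : ℕ} (u : C(UnitAddTorus (Fin d), ℂ)) (f : L1Torus d) :
    Integrable (fun t => u t * f t) (torusMeasure d) :=
  (L1.integrable_coeFn f).bdd_mul u.continuous.aestronglyMeasurable
    (Eventually.of_forall fun t => u.norm_coe_le_norm t)

/-- The `k`-th Fourier coefficient as a linear functional on `L₁`. -/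
noncomputable def coeffL {d : ℕ} (k : Fin d → ℤ) : L1Torus d →ₗ[ℂ] ℂ where
  toFun f := mFourierCoeff f k
  map_add' f g := by
    rw [mFourierCoeff_def, mFourierCoeff_def, mFourierCoeff_def,
      ← integral_add (integrable_continuousMap_mul _ f) (integrable_continuousMap_mul _ g)]
    refine integral_congr_ae ?_
    filter_upwards [Lp.coeFn_add f g] with t ht
    rw [ht, Pi.add_apply, mul_add]
  map_smul' a f := by
    rw [mFourierCoeff_def, mFourierCoeff_def, RingHom.id_apply, smul_eq_mul,
      ← integral_const_mul]
    refine integral_congr_ae ?_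
    filter_upwards [Lp.coeFn_smul a f] with t ht
    rw [ht, Pi.smul_apply, smul_eq_mul]
    ring

lemma coeffL_apply {d : ℕ} (k : Fin d → ℤ) (f : L1Torus d) :
    coeffL k f = mFourierCoeff f k := rfl

lemma coeffL_trigFun {d : ℕ} (k j : Fin d → ℤ) :
    coeffL j (trigFun k) = if j = k then 1 else 0 := by
  have h := orthonormal_iff_ite.mp (orthonormal_mFourier (d := Fin d)) j k
  rw [← h, coeffL_apply, mFourierCoeff_def, ContinuousMap.inner_toLp]
  refine integral_congr_ae ?_
  filter_upwards [coeFn_trigFun k] with t ht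
  rw [ht, mFourier_neg, mul_comm]

/-- A continuous function is integrated to zero against an integrable function all of whose
Fourier coefficients vanish, since trigonometric polynomials are uniformly dense. -/
lemma integral_continuousMap_mul_eq_zero {d : ℕ} {f : L1Torus d} (hf : ∀ k, coeffL k f = 0)
    (u : C(UnitAddTorus (Fin d), ℂ)) : ∫ t, u t * f t ∂(torusMeasure d) = 0 := by
  let I : C(UnitAddTorus (Fin d), ℂ) →ₗ[ℂ] ℂ :=
    { toFun := fun u => ∫ t, u t * f t ∂(torusMeasure d)
      map_add' := fun u w => by
        rw [← integral_add (integrable_continuousMap_mul _ f) (integrable_continuousMap_mul _ f)]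
        exact integral_congr_ae (Eventually.of_forall fun t => add_mul _ _ _)
      map_smul' := fun a u => by
        rw [RingHom.id_apply, smul_eq_mul, ← integral_const_mul]
        exact integral_congr_ae (Eventually.of_forall fun t => mul_assoc _ _ _) }
  have hbound : ∀ u, ‖I u‖ ≤ (∫ t, ‖f t‖ ∂(torusMeasure d)) * ‖u‖ := by
    intro u
    rw [mul_comm, ← integral_const_mul]
    refine norm_integral_le_of_norm_le ((L1.integrable_coeFn f).norm.const_mul _)
      (Eventually.of_forall fun t => ?_)
    rw [norm_mul]
    gcongr
    exact u.norm_coe_le_norm t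
  let J : C(UnitAddTorus (Fin d), ℂ) →L[ℂ] ℂ := I.mkContinuous _ hbound
  have hspan : Submodule.span ℂ (Set.range (mFourier (d := Fin d))) ≤ J.ker := by
    rw [Submodule.span_le]
    rintro _ ⟨k, rfl⟩
    have := hf (-k)
    rw [coeffL_apply, mFourierCoeff_def, neg_neg] at this
    exact this
  have htop := Submodule.topologicalClosure_minimal _ hspan J.isClosed_ker
  rw [span_mFourier_closure_eq_top] at htop
  exact htop (Submodule.mem_top (x := u))

/-- **Uniqueness theorem** for Fourier series of integrable functions. -/
lemma eq_zero_of_coeffL_eq_zero {d : ℕ} {f : L1Torus d} (hf : ∀ k, coeffL k f = 0) : f = 0 := by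
  rw [Lp.eq_zero_iff_ae_eq_zero]
  have hint := L1.integrable_coeFn f
  refine ae_eq_zero_of_forall_setIntegral_isClosed_eq_zero hint fun K hK => ?_
  -- the indicator of `K` is a bounded pointwise limit of continuous functions
  let u : ℕ → UnitAddTorus (Fin d) → ℂ := fun n t =>
    (((thickenedIndicator (Nat.one_div_pos_of_nat (α := ℝ) (n := n)) K t : NNReal) : ℝ) : ℂ)
  have huc : ∀ n, Continuous (u n) := fun n => by fun_prop
  have hlim : Tendsto (fun n => ∫ t, u n t * f t ∂(torusMeasure d)) atTop
      (𝓝 (∫ t, K.indicator (fun _ => (1 : ℂ)) t * f t ∂(torusMeasure d))) := by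
    refine tendsto_integral_of_dominated_convergence (fun t => ‖f t‖) (fun n => ?_) hint.norm
      (fun n => Eventually.of_forall fun t => ?_) (Eventually.of_forall fun t => ?_)
    · exact (huc n).aestronglyMeasurable.mul hint.aestronglyMeasurable
    · rw [norm_mul]
      refine mul_le_of_le_one_left (norm_nonneg _) ?_
      simp only [u, Complex.norm_real, NNReal.norm_eq]
      exact_mod_cast thickenedIndicator_le_one _ K t
    · refine Tendsto.mul_const _ ?_
      have h := thickenedIndicator_tendsto_indicator_closure
        (fun n => Nat.one_div_pos_of_nat (α := ℝ) (n := n))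
        tendsto_one_div_add_atTop_nhds_zero_nat K
      rw [tendsto_pi_nhds] at h
      have h' := (Complex.continuous_ofReal.comp NNReal.continuous_coe).continuousAt.tendsto.comp
        (h t)
      rw [hK.closure_eq] at h'
      have hval : K.indicator (fun _ => (1 : ℂ)) t
          = (Complex.ofReal ∘ NNReal.toReal) (K.indicator (fun _ => 1) t) := by
        by_cases ht : t ∈ K <;> simp [ht]
      rw [hval]
      exact h'
  have hzero : ∀ n, ∫ t, u n t * f t ∂(torusMeasure d) = 0 := fun n =>
    integral_continuousMap_mul_eq_zero hf ⟨u n, huc n⟩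
  have h0 := tendsto_nhds_unique hlim ((tendsto_congr hzero).mpr tendsto_const_nhds)
  rw [← integral_indicator hK.measurableSet, ← h0]
  refine integral_congr_ae (Eventually.of_forall fun t => ?_)
  by_cases ht : t ∈ K <;> simp [ht]

/-- Parseval's identity for a function of class `L₂`, in extended nonnegative reals. -/
lemma tsum_coeff_sq_of_memLp {d : ℕ} {f : L1Torus d} (hf : MemLp f 2 (torusMeasure d)) :
    ∑' k, ‖mFourierCoeff f k‖ₑ ^ (2 : ℝ) = l2Norm f ^ (2 : ℝ) := by
  have h := hasSum_sq_mFourierCoeff (hf.toLp f)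
  have hc : ∀ k, mFourierCoeff (hf.toLp f) k = mFourierCoeff f k := fun k => by
    rw [mFourierCoeff_def, mFourierCoeff_def]
    refine integral_congr_ae ?_
    filter_upwards [hf.coeFn_toLp] with t ht
    rw [ht]
  simp_rw [hc] at h
  have hI : ∫ t, ‖(hf.toLp f : UnitAddTorus (Fin d) → ℂ) t‖ ^ 2 ∂(torusMeasure d)
      = (l2Norm f).toReal ^ 2 := by
    have h1 : ∫ t, ‖(hf.toLp f : UnitAddTorus (Fin d) → ℂ) t‖ ^ 2 ∂(torusMeasure d)
        = ∫ t, ‖f t‖ ^ 2 ∂(torusMeasure d) := by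
      refine integral_congr_ae ?_
      filter_upwards [hf.coeFn_toLp] with t ht
      rw [ht]
    rw [h1, l2Norm, hf.eLpNorm_eq_integral_rpow_norm two_ne_zero ENNReal.ofNat_ne_top,
      ENNReal.toReal_ofReal (by positivity)]
    have h0 : 0 ≤ ∫ t, ‖f t‖ ^ 2 ∂(torusMeasure d) := integral_nonneg fun t => by positivity
    simp only [ENNReal.toReal_ofNat, Real.rpow_ofNat]
    rw [← Real.rpow_natCast, ← Real.rpow_mul h0]
    norm_num
  replace h : HasSum (fun k => ‖mFourierCoeff f k‖ ^ 2) ((l2Norm f).toReal ^ 2) := by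
    rw [← hI]; exact h
  have hfin : l2Norm f ≠ ∞ := hf.eLpNorm_ne_top
  have h2 := ENNReal.ofReal_tsum_of_nonneg (fun k => by positivity) h.summable
  rw [h.tsum_eq, ENNReal.ofReal_pow ENNReal.toReal_nonneg, ENNReal.ofReal_toReal hfin] at h2
  rw [ENNReal.rpow_ofNat, h2]
  refine tsum_congr fun k => ?_
  rw [ENNReal.rpow_ofNat, ENNReal.ofReal_pow (norm_nonneg _), ofReal_norm]

/-- **Parseval's identity** on all of `L₁`: both sides are infinite outside of `L₂`. -/
lemma tsum_coeff_sq {d : ℕ} (f : L1Torus d) :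
    ∑' k, ‖mFourierCoeff f k‖ₑ ^ (2 : ℝ) = l2Norm f ^ (2 : ℝ) := by
  by_cases hf : MemLp f 2 (torusMeasure d)
  · exact tsum_coeff_sq_of_memLp hf
  have hl : l2Norm f = ∞ := by
    by_contra h
    exact hf ⟨Lp.aestronglyMeasurable f, lt_top_iff_ne_top.mpr h⟩
  rw [hl, ENNReal.top_rpow_of_pos two_pos]
  by_contra hsum
  refine hf ?_
  -- the square-summable coefficients are those of a function `g` in `L₂`, which has to equal `f`
  have hmem : Memℓp (fun k => mFourierCoeff f k) 2 := by
    refine memℓp_gen ?_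
    have := ENNReal.summable_toReal hsum
    refine this.congr fun k => ?_
    rw [← ENNReal.toReal_rpow, toReal_enorm, ENNReal.toReal_ofNat]
  let g : Lp ℂ 2 (torusMeasure d) := (mFourierBasis (d := Fin d)).repr.symm ⟨_, hmem⟩
  have hg : ∀ k, mFourierCoeff g k = mFourierCoeff f k := fun k => by
    have := mFourierBasis_repr (d := Fin d) g k
    rw [← this]
    simp only [g, LinearIsometryEquiv.apply_symm_apply]
  have hg1 : MemLp g 1 (torusMeasure d) := (Lp.memLp g).mono_exponent one_le_two
  have hzero : f - hg1.toLp g = 0 := by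
    refine eq_zero_of_coeffL_eq_zero fun k => ?_
    rw [map_sub, coeffL_apply, coeffL_apply, ← hg k, sub_eq_zero]
    rw [mFourierCoeff_def, mFourierCoeff_def]
    refine integral_congr_ae ?_
    filter_upwards [hg1.coeFn_toLp] with t ht
    rw [ht]
  rw [sub_eq_zero] at hzero
  have : f =ᵐ[torusMeasure d] g := by
    rw [hzero]; exact hg1.coeFn_toLp
  exact (memLp_congr_ae this).mpr (Lp.memLp g)

lemma l2Norm_eq_weightedNorm {d : ℕ} (f : L1Torus d) :
    l2Norm f = weightedNorm (fun _ => 1) 2 f := by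
  simp only [weightedNorm, Complex.ofReal_one, one_mul]
  rw [tsum_coeff_sq, ← ENNReal.rpow_mul]
  norm_num

/-! ### Two-sided bounds for the widths of a weighted class -/

lemma exists_max_off_finset {ι : Type*} [Infinite ι] {c : ι → ℝ} (hc : ∀ k, 0 ≤ c k)
    (hlim : Tendsto c cofinite (𝓝 0)) (Λ : Finset ι) : ∃ k ∉ Λ, ∀ j ∉ Λ, c j ≤ c k := by
  classical
  by_cases h0 : ∀ j ∉ Λ, c j = 0
  · obtain ⟨k, hk⟩ := Infinite.exists_notMem_finset Λ
    exact ⟨k, hk, fun j hj => by rw [h0 j hj, h0 k hk]⟩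
  push Not at h0
  obtain ⟨i, hi, hi0⟩ := h0
  have hpos : 0 < c i := lt_of_le_of_ne (hc i) (Ne.symm hi0)
  have hfin : {j | c i ≤ c j}.Finite := by
    have := hlim.eventually_lt_const hpos
    rw [eventually_cofinite] at this
    simpa only [not_lt] using this
  have hmem : i ∈ hfin.toFinset \ Λ := by simp [hi]
  obtain ⟨k, hk, hmax⟩ := Finset.exists_max_image (hfin.toFinset \ Λ) c ⟨i, hmem⟩
  rw [Finset.mem_sdiff] at hk
  refine ⟨k, hk.2, fun j hj => ?_⟩
  by_cases hji : c i ≤ c j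
  · exact hmax j (by simp [hj, hji])
  · exact (not_le.mp hji).le.trans (hmax i hmem)

/-- A null family has `n` largest members. -/
lemma exists_largest {ι : Type*} [Infinite ι] {c : ι → ℝ} (hc : ∀ k, 0 ≤ c k)
    (hlim : Tendsto c cofinite (𝓝 0)) (n : ℕ) :
    ∃ Λ : Finset ι, Λ.card = n ∧ ∀ k ∈ Λ, ∀ j ∉ Λ, c j ≤ c k := by
  classical
  induction n with
  | zero => exact ⟨∅, rfl, by simp⟩
  | succ n ih =>
    obtain ⟨Λ, hcard, hΛ⟩ := ih
    obtain ⟨k, hk, hmax⟩ := exists_max_off_finset hc hlim Λ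
    refine ⟨insert k Λ, by rw [Finset.card_insert_of_notMem hk, hcard], fun i hi j hj => ?_⟩
    rw [Finset.mem_insert, not_or] at hj
    rcases Finset.mem_insert.mp hi with rfl | hi
    · exact hmax j hj.2
    · exact hΛ i hi j hj.2

lemma coeffL_sub_sum {d n : ℕ} (f : L1Torus d) (a : Fin n → ℂ) (k : Fin n → Fin d → ℤ)
    (j : Fin d → ℤ) :
    coeffL j (f - ∑ i, a i • trigFun (k i))
      = coeffL j f - ∑ i, if j = k i then a i else 0 := by
  simp [map_sub, map_sum, coeffL_trigFun]

lemma enorm_ofReal_mul_rpow {ω : ℝ} (hω : 0 ≤ ω) (c : ℂ) {p : ℝ} (hp : 0 < p) :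
    ‖(ω : ℂ) * c‖ₑ ^ p = ENNReal.ofReal ((ω * ‖c‖) ^ p) := by
  rw [← ofReal_norm, norm_mul, Complex.norm_real, Real.norm_of_nonneg hω,
    ENNReal.ofReal_rpow_of_nonneg (by positivity) hp.le]

lemma weightedNorm_le_ofReal {d : ℕ} {ω : (Fin d → ℤ) → ℝ} (hω : ∀ k, 0 ≤ ω k) {p q : ℝ}
    (hp : 0 < p) (hq : 0 ≤ q) {f : L1Torus d}
    (h : ∀ F : Finset (Fin d → ℤ), ∑ k ∈ F, (ω k * ‖coeffL k f‖) ^ p ≤ q ^ p) :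
    weightedNorm ω p f ≤ ENNReal.ofReal q := by
  rw [weightedNorm, one_div, ENNReal.rpow_inv_le_iff hp,
    ENNReal.ofReal_rpow_of_nonneg hq hp.le, ENNReal.tsum_eq_iSup_sum]
  refine iSup_le fun F => ?_
  simp_rw [enorm_ofReal_mul_rpow (hω _) _ hp]
  rw [← ENNReal.ofReal_sum_of_nonneg fun k _ =>
    Real.rpow_nonneg (mul_nonneg (hω k) (norm_nonneg _)) p]
  exact ENNReal.ofReal_le_ofReal (h F)

lemma ofReal_le_weightedNorm {d : ℕ} {ω : (Fin d → ℤ) → ℝ} (hω : ∀ k, 0 ≤ ω k) {p q : ℝ}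
    (hp : 0 < p) (hq : 0 ≤ q) {f : L1Torus d} (F : Finset (Fin d → ℤ))
    (h : q ^ p ≤ ∑ k ∈ F, (ω k * ‖coeffL k f‖) ^ p) :
    ENNReal.ofReal q ≤ weightedNorm ω p f := by
  rw [weightedNorm, one_div, ENNReal.le_rpow_inv_iff hp,
    ENNReal.ofReal_rpow_of_nonneg hq hp.le]
  refine le_trans ?_ (ENNReal.sum_le_tsum F)
  simp_rw [enorm_ofReal_mul_rpow (hω _) _ hp]
  rw [← ENNReal.ofReal_sum_of_nonneg fun k _ =>
    Real.rpow_nonneg (mul_nonneg (hω k) (norm_nonneg _)) p]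
  exact ENNReal.ofReal_le_ofReal h

/-- An upper bound for the width follows from an inequality for finite families `x` in
`[0, τ]`. Here `τ` stands for the largest coefficient that is not used by the approximant, and
`x` for the coefficients cut off at height `τ`. -/
lemma nTermWidth_le {d : ℕ} (hd : 1 ≤ d) {ω : (Fin d → ℤ) → ℝ} (hω : ∀ k, 1 ≤ ω k) {p q : ℝ}
    (hp : 0 < p) (hq : 0 ≤ q) (n : ℕ)
    (H : ∀ (G : Finset (Fin d → ℤ)) (x : (Fin d → ℤ) → ℝ) (τ : ℝ), 0 ≤ τ →
      (∀ k, 0 ≤ x k) → (∀ k, x k ≤ τ) → ∑ k ∈ G, (ω k * x k) ^ 2 ≤ 1 →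
      ∑ k ∈ G, x k ^ p ≤ q ^ p + n * τ ^ p) :
    nTermWidth (weightedNorm ω 2) (weightedNorm (fun _ => 1) p) (trigSystem d) n
      ≤ ENNReal.ofReal q := by
  classical
  have : Nonempty (Fin d) := ⟨⟨0, hd⟩⟩
  refine iSup₂_le fun f hf => ?_
  have hω0 : ∀ k, 0 ≤ ω k := fun k => zero_le_one.trans (hω k)
  set c : (Fin d → ℤ) → ℝ := fun k => ‖coeffL k f‖ with hc
  have hc0 : ∀ k, 0 ≤ c k := fun k => norm_nonneg _
  have hsum : ∀ F : Finset (Fin d → ℤ), ∑ k ∈ F, (ω k * c k) ^ 2 ≤ 1 := by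
    intro F
    have h1 : ENNReal.ofReal (√(∑ k ∈ F, (ω k * c k) ^ 2)) ≤ weightedNorm ω 2 f := by
      refine ofReal_le_weightedNorm hω0 two_pos (Real.sqrt_nonneg _) F ?_
      simp only [Real.rpow_ofNat]
      rw [Real.sq_sqrt (Finset.sum_nonneg fun k _ => sq_nonneg _)]
    have h2 := h1.trans hf
    rw [ENNReal.ofReal_le_one, Real.sqrt_le_iff, one_pow] at h2
    exact h2.2
  have hlim : Tendsto c cofinite (𝓝 0) := by
    have hs : Summable fun k => (ω k * c k) ^ 2 :=
      summable_of_sum_le (fun k => sq_nonneg _) hsum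
    have h0 := hs.tendsto_cofinite_zero
    have h1 : Tendsto (fun k => √((ω k * c k) ^ 2)) cofinite (𝓝 0) := by
      simpa using h0.sqrt
    refine squeeze_zero hc0 (fun k => ?_) h1
    rw [Real.sqrt_sq (mul_nonneg (hω0 k) (hc0 k))]
    exact le_mul_of_one_le_left (hc0 k) (hω k)
  obtain ⟨Λ, hcard, hΛ⟩ := exists_largest hc0 hlim n
  obtain ⟨k₀, hk₀, hmax⟩ := exists_max_off_finset hc0 hlim Λ
  let e := Λ.equivFinOfCardEq hcard
  let k : Fin n → Fin d → ℤ := fun i => (e.symm i : Fin d → ℤ)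
  have hmem : ∀ i, trigFun (k i) ∈ trigSystem d := fun i => ⟨k i, rfl⟩
  refine (iInf₂_le (fun i => coeffL (k i) f) (fun i => ⟨trigFun (k i), hmem i⟩)).trans ?_
  have hcoef : ∀ j, coeffL j (f - ∑ i, coeffL (k i) f • trigFun (k i))
      = if j ∈ Λ then 0 else coeffL j f := by
    intro j
    rw [coeffL_sub_sum]
    split_ifs with hj
    · rw [Finset.sum_eq_single (e ⟨j, hj⟩)]
      · simp [k]
      · intro i _ hi
        rw [if_neg]
        rintro rfl
        exact hi (by simp [k])
      · simp
    · rw [Finset.sum_eq_zero, sub_zero]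
      intro i _
      rw [if_neg]
      rintro rfl
      exact hj (e.symm i).2
  refine weightedNorm_le_ofReal (fun _ => zero_le_one) hp hq fun F => ?_
  simp_rw [hcoef, one_mul]
  set τ := c k₀ with hτ
  have hτ0 : 0 ≤ τ := hc0 k₀
  have key := H (F ∪ Λ) (fun j => min (c j) τ) τ hτ0 (fun j => le_min (hc0 j) hτ0)
    (fun j => min_le_right _ _) (le_trans (Finset.sum_le_sum fun j _ => by
      have := hω0 j
      have := hc0 j
      gcongr
      exact min_le_left _ _) (hsum (F ∪ Λ)))
  rw [← Finset.sdiff_union_self_eq_union, Finset.sum_union Finset.sdiff_disjoint] at key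
  have h1 : ∑ j ∈ Λ, min (c j) τ ^ p = n * τ ^ p := by
    rw [← hcard, ← nsmul_eq_mul]
    refine Finset.sum_eq_card_nsmul fun j hj => ?_
    rw [min_eq_right (hΛ j hj k₀ hk₀)]
  have h2 : ∑ j ∈ F \ Λ, min (c j) τ ^ p = ∑ j ∈ F, ‖if j ∈ Λ then 0 else coeffL j f‖ ^ p := by
    rw [Finset.sdiff_eq_filter, Finset.sum_filter]
    refine Finset.sum_congr rfl fun j _ => ?_
    by_cases hj : j ∈ Λ
    · simp [hj, Real.zero_rpow hp.ne']
    · rw [if_pos hj, if_neg hj, min_eq_left (hmax j hj)]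
  linarith

/-- A lower bound for the width, from the trigonometric polynomial with coefficients `c` on the
finite set `F`. -/
lemma ofReal_le_nTermWidth {d : ℕ} {ω : (Fin d → ℤ) → ℝ} (hω : ∀ k, 0 ≤ ω k) {p q : ℝ}
    (hp : 0 < p) (hq : 0 ≤ q) (n : ℕ) (F : Finset (Fin d → ℤ)) (c : (Fin d → ℤ) → ℝ) {τ : ℝ}
    (hc0 : ∀ k ∈ F, 0 ≤ c k) (hcτ : ∀ k ∈ F, c k ≤ τ) (hτ : 0 ≤ τ)
    (hc : ∑ k ∈ F, (ω k * c k) ^ 2 ≤ 1)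
    (hqp : q ^ p ≤ ∑ k ∈ F, c k ^ p - n * τ ^ p) :
    ENNReal.ofReal q
      ≤ nTermWidth (weightedNorm ω 2) (weightedNorm (fun _ => 1) p) (trigSystem d) n := by
  classical
  let f : L1Torus d := ∑ k ∈ F, (c k : ℂ) • trigFun k
  have hcoef : ∀ j, coeffL j f = if j ∈ F then (c j : ℂ) else 0 := by
    intro j
    simp [f, map_sum, coeffL_trigFun]
  have hnorm : ∀ j, ‖coeffL j f‖ = if j ∈ F then c j else 0 := by
    intro j
    rw [hcoef]
    split_ifs with hj
    · rw [Complex.norm_real, Real.norm_of_nonneg (hc0 j hj)]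
    · exact norm_zero
  have hf : weightedNorm ω 2 f ≤ 1 := by
    rw [← ENNReal.ofReal_one]
    refine weightedNorm_le_ofReal hω two_pos zero_le_one fun G => ?_
    simp only [Real.rpow_ofNat, one_pow, hnorm]
    refine le_trans ?_ hc
    have : ∀ k, (ω k * if k ∈ F then c k else 0) ^ 2 = if k ∈ F then (ω k * c k) ^ 2 else 0 := by
      intro k
      split_ifs <;> simp
    simp_rw [this]
    rw [← Finset.sum_filter]
    refine Finset.sum_le_sum_of_subset_of_nonneg (fun k hk => ?_) fun k _ _ => sq_nonneg _
    exact (Finset.mem_filter.mp hk).2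
  refine le_trans ?_ (le_iSup₂ (f := fun x (_ : weightedNorm ω 2 x ≤ 1) =>
    nTermError (weightedNorm (fun _ => 1) p) (trigSystem d) n x) f hf)
  refine le_iInf₂ fun a e => ?_
  have he : ∀ i, ∃ k, (e i : L1Torus d) = trigFun k := fun i => by
    obtain ⟨k, hk⟩ := (e i).2
    exact ⟨k, hk.symm⟩
  choose k hk using he
  let K := Finset.univ.image k
  refine ofReal_le_weightedNorm (fun _ => zero_le_one) hp hq (F \ K) ?_
  have hK : ∀ j ∈ F \ K, (1 * ‖coeffL j (f - ∑ i, a i • (e i : L1Torus d))‖) ^ p = c j ^ p := by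
    intro j hj
    rw [Finset.mem_sdiff] at hj
    simp_rw [hk]
    rw [coeffL_sub_sum, Finset.sum_eq_zero, sub_zero, one_mul, hnorm, if_pos hj.1]
    intro i _
    rw [if_neg]
    rintro rfl
    exact hj.2 (Finset.mem_image_of_mem k (Finset.mem_univ i))
  rw [Finset.sum_congr rfl hK]
  refine hqp.trans ?_
  have h1 : ∑ j ∈ F ∩ K, c j ^ p ≤ n * τ ^ p := by
    have hcardK : ((F ∩ K).card : ℝ) ≤ n := by
      have h2 : (F ∩ K).card ≤ K.card := Finset.card_le_card Finset.inter_subset_right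
      have h3 : K.card ≤ n := by simpa using Finset.card_image_le (s := Finset.univ) (f := k)
      exact_mod_cast h2.trans h3
    calc ∑ j ∈ F ∩ K, c j ^ p ≤ ∑ j ∈ F ∩ K, τ ^ p := by
          refine Finset.sum_le_sum fun j hj => ?_
          have hj := (Finset.mem_inter.mp hj).1
          exact Real.rpow_le_rpow (hc0 j hj) (hcτ j hj) hp.le
      _ = (F ∩ K).card * τ ^ p := by rw [Finset.sum_const, nsmul_eq_mul]
      _ ≤ n * τ ^ p := by gcongr
  have h2 := Finset.sum_inter_add_sum_sdiff F K (fun j => c j ^ p)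
  linarith

/-- The share of a frequency of relative weight `x` (its weight divided by the threshold) that
counts as discarded. -/
noncomputable def clip (x : ℝ) : ℝ := min 1 (x ^ 2)

lemma clip_nonneg (x : ℝ) : 0 ≤ clip x := le_min zero_le_one (sq_nonneg x)

lemma clip_le_one (x : ℝ) : clip x ≤ 1 := min_le_left _ _

lemma clip_le_sq (x : ℝ) : clip x ≤ x ^ 2 := min_le_right _ _

lemma clip_pos {x : ℝ} (hx : 0 < x) : 0 < clip x := lt_min one_pos (by positivity)

lemma clip_eq_one_or (x : ℝ) : clip x = 1 ∨ clip x = x ^ 2 := by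
  unfold clip
  exact min_choice _ _

/-- If the numbers `1 - clip (ω k / T)` add up to at most `n`, then the width in `L₂` is at most
`1 / T`. -/
lemma l2_width_le {d : ℕ} (hd : 1 ≤ d) {ω : (Fin d → ℤ) → ℝ} (hω : ∀ k, 1 ≤ ω k) {T : ℝ}
    (hT : 0 < T) (n : ℕ)
    (hn : ∀ G : Finset (Fin d → ℤ), ∑ k ∈ G, (1 - clip (ω k / T)) ≤ n) :
    nTermWidth (weightedNorm ω 2) (weightedNorm (fun _ => 1) 2) (trigSystem d) n
      ≤ ENNReal.ofReal (1 / T) := by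
  refine nTermWidth_le hd hω two_pos (by positivity) n fun G x τ hτ hx0 hxτ hx => ?_
  simp only [Real.rpow_ofNat]
  calc ∑ k ∈ G, x k ^ 2
      ≤ ∑ k ∈ G, ((1 / T) ^ 2 * (ω k * x k) ^ 2 + (1 - clip (ω k / T)) * τ ^ 2) := by
        refine Finset.sum_le_sum fun k _ => ?_
        have h1 := clip_le_sq (ω k / T)
        have h2 : x k ^ 2 ≤ τ ^ 2 := pow_le_pow_left₀ (hx0 k) (hxτ k) 2
        have h3 : (1 / T) ^ 2 * (ω k * x k) ^ 2 = (ω k / T) ^ 2 * x k ^ 2 := by ring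
        rw [h3]
        nlinarith [mul_le_mul_of_nonneg_right h1 (sq_nonneg (x k)),
          mul_le_mul_of_nonneg_left h2 (sub_nonneg.mpr (clip_le_one (ω k / T)))]
    _ = (1 / T) ^ 2 * ∑ k ∈ G, (ω k * x k) ^ 2
        + (∑ k ∈ G, (1 - clip (ω k / T))) * τ ^ 2 := by
        rw [Finset.sum_add_distrib, Finset.mul_sum, Finset.sum_mul]
    _ ≤ (1 / T) ^ 2 * 1 + n * τ ^ 2 := by
        gcongr
        exact hn G
    _ = _ := by rw [mul_one]

/-- If the numbers `1 - clip (ω k / T)` add up to at least `n`, then the width in `L₂` is at least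
`1 / T`; the extremal function has equal coefficients on `{ω < T}`. -/
lemma le_l2_width {d : ℕ} {ω : (Fin d → ℤ) → ℝ} (hω : ∀ k, 1 ≤ ω k) {T : ℝ}
    (hT : 0 < T) {n : ℕ} (hn0 : 0 < n) (F : Finset (Fin d → ℤ))
    (hn : (n : ℝ) ≤ ∑ k ∈ F, (1 - clip (ω k / T))) :
    ENNReal.ofReal (1 / T)
      ≤ nTermWidth (weightedNorm ω 2) (weightedNorm (fun _ => 1) 2) (trigSystem d) n := by
  classical
  have hω0 : ∀ k, 0 < ω k := fun k => zero_lt_one.trans_le (hω k)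
  set S := F.filter fun k => clip (ω k / T) ≠ 1 with hS
  have hclip : ∀ k ∈ S, clip (ω k / T) = (ω k / T) ^ 2 := fun k hk =>
    (clip_eq_one_or _).resolve_left (Finset.mem_filter.mp hk).2
  have hsum : ∑ k ∈ F, (1 - clip (ω k / T)) = S.card - (∑ k ∈ S, ω k ^ 2) / T ^ 2 := by
    have h1 : ∑ k ∈ S, (1 - clip (ω k / T)) = ∑ k ∈ F, (1 - clip (ω k / T)) := by
      refine Finset.sum_filter_of_ne fun k _ hk h => hk ?_
      rw [h, sub_self]
    rw [← h1, Finset.sum_sub_distrib, Finset.sum_congr rfl hclip, Finset.sum_div]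
    simp [div_pow]
  have hne : S.Nonempty := by
    rw [Finset.nonempty_iff_ne_empty]
    intro h
    rw [hsum, h] at hn
    have : (0 : ℝ) < n := by exact_mod_cast hn0
    simp at hn
    linarith
  set W := ∑ k ∈ S, ω k ^ 2 with hW
  have hWpos : 0 < W := Finset.sum_pos (fun k _ => pow_pos (hω0 k) 2) hne
  have hsq : (1 / √W) ^ 2 = 1 / W := by rw [div_pow, Real.sq_sqrt hWpos.le, one_pow]
  refine ofReal_le_nTermWidth (fun k => (hω0 k).le) two_pos (by positivity) n S
    (fun _ => 1 / √W) (τ := 1 / √W) (fun _ _ => by positivity) (fun _ _ => le_rfl)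
    (by positivity) ?_ ?_
  · simp_rw [mul_pow, hsq]
    rw [← Finset.sum_mul, ← hW, mul_one_div_cancel hWpos.ne']
  · simp only [Real.rpow_ofNat, Finset.sum_const, nsmul_eq_mul]
    rw [hsq, ← sub_mul, mul_one_div, le_div_iff₀ hWpos]
    rw [hsum] at hn
    have : (1 / T) ^ 2 * W = W / T ^ 2 := by ring
    rw [this]
    linarith

/-- The counterpart of `l2_width_le` for the Wiener algebra. -/
lemma wiener_width_le {d : ℕ} (hd : 1 ≤ d) {ω : (Fin d → ℤ) → ℝ} (hω : ∀ k, 1 ≤ ω k) {T q : ℝ}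
    (n : ℕ)
    (hn : ∀ G : Finset (Fin d → ℤ), ∑ k ∈ G, (1 - clip (ω k / T)) ≤ n)
    (hQ : ∀ G : Finset (Fin d → ℤ), ∑ k ∈ G, (clip (ω k / T) / ω k) ^ 2 ≤ q) :
    nTermWidth (weightedNorm ω 2) (weightedNorm (fun _ => 1) 1) (trigSystem d) n
      ≤ ENNReal.ofReal (√q) := by
  have hω0 : ∀ k, 0 < ω k := fun k => zero_lt_one.trans_le (hω k)
  refine nTermWidth_le hd hω one_pos (Real.sqrt_nonneg q) n fun G x τ hτ hx0 hxτ hx => ?_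
  simp only [Real.rpow_one]
  have hCS : ∑ k ∈ G, (ω k * x k) * (clip (ω k / T) / ω k) ≤ √q := by
    refine (Real.sum_mul_le_sqrt_mul_sqrt G _ _).trans ?_
    calc _ ≤ √1 * √q := by
          gcongr
          exact hQ G
      _ = √q := by rw [Real.sqrt_one, one_mul]
  calc ∑ k ∈ G, x k
      ≤ ∑ k ∈ G, ((ω k * x k) * (clip (ω k / T) / ω k) + (1 - clip (ω k / T)) * τ) := by
        refine Finset.sum_le_sum fun k _ => ?_
        have h3 : (ω k * x k) * (clip (ω k / T) / ω k) = x k * clip (ω k / T) := by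
          field_simp [(hω0 k).ne']
        rw [h3]
        nlinarith [mul_le_mul_of_nonneg_left (hxτ k) (sub_nonneg.mpr (clip_le_one (ω k / T)))]
    _ = ∑ k ∈ G, (ω k * x k) * (clip (ω k / T) / ω k)
        + (∑ k ∈ G, (1 - clip (ω k / T))) * τ := by
        rw [Finset.sum_add_distrib, Finset.sum_mul]
    _ ≤ √q + n * τ := by
        gcongr
        exact hn G

/-- The counterpart of `le_l2_width` for the Wiener algebra; the extremal function has the
coefficients `min (ω k ^ (-2)) (T ^ (-2))`. -/
lemma le_wiener_width {d : ℕ} {ω : (Fin d → ℤ) → ℝ} (hω : ∀ k, 1 ≤ ω k) {T : ℝ}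
    (hT : 0 < T) {n : ℕ} (hn0 : 0 < n) (F : Finset (Fin d → ℤ))
    (hn : (n : ℝ) ≤ ∑ k ∈ F, (1 - clip (ω k / T))) :
    ENNReal.ofReal (√(∑ k ∈ F, (clip (ω k / T) / ω k) ^ 2))
      ≤ nTermWidth (weightedNorm ω 2) (weightedNorm (fun _ => 1) 1) (trigSystem d) n := by
  have hω0 : ∀ k, 0 < ω k := fun k => zero_lt_one.trans_le (hω k)
  have hne : F.Nonempty := by
    rw [Finset.nonempty_iff_ne_empty]
    rintro rfl
    have : (0 : ℝ) < n := by exact_mod_cast hn0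
    simp at hn
    linarith
  set q := ∑ k ∈ F, (clip (ω k / T) / ω k) ^ 2 with hq
  have hqpos : 0 < q := Finset.sum_pos
    (fun k _ => pow_pos (div_pos (clip_pos (div_pos (hω0 k) hT)) (hω0 k)) 2) hne
  have hsqrt : 0 < √q := Real.sqrt_pos.mpr hqpos
  refine ofReal_le_nTermWidth (fun k => (hω0 k).le) one_pos (Real.sqrt_nonneg q) n F
    (fun k => clip (ω k / T) / ω k ^ 2 / √q) (τ := 1 / T ^ 2 / √q)
    (fun k _ => by have := clip_nonneg (ω k / T); positivity) (fun k _ => ?_)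
    (by positivity) ?_ ?_
  · gcongr ?_ / _
    rw [div_le_div_iff₀ (pow_pos (hω0 k) 2) (by positivity)]
    have h := clip_le_sq (ω k / T)
    rw [div_pow, le_div_iff₀ (by positivity)] at h
    linarith
  · have : ∀ k, (ω k * (clip (ω k / T) / ω k ^ 2 / √q)) ^ 2
        = (clip (ω k / T) / ω k) ^ 2 / q := fun k => by
      have h1 : ω k * (clip (ω k / T) / ω k ^ 2 / √q) = clip (ω k / T) / ω k / √q := by
        have := (hω0 k).ne'
        field_simp
      rw [h1, div_pow _ (√q), Real.sq_sqrt hqpos.le]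
    simp_rw [this]
    rw [← Finset.sum_div, ← hq, div_self hqpos.ne']
  · simp only [Real.rpow_one]
    have h1 : ∑ k ∈ F, clip (ω k / T) / ω k ^ 2
        = q + (∑ k ∈ F, (1 - clip (ω k / T))) / T ^ 2 := by
      rw [hq, Finset.sum_div, ← Finset.sum_add_distrib]
      refine Finset.sum_congr rfl fun k _ => ?_
      have := (hω0 k).ne'
      rcases clip_eq_one_or (ω k / T) with h | h <;> rw [h] <;> field_simp <;> ring
    rw [← Finset.sum_div, h1, ← mul_div_assoc, ← sub_div, le_div_iff₀ hsqrt,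
      Real.mul_self_sqrt hqpos.le]
    have h2 : (n : ℝ) * (1 / T ^ 2) ≤ (∑ k ∈ F, (1 - clip (ω k / T))) / T ^ 2 := by
      rw [mul_one_div]
      gcongr
    linarith

/-! ### Integrals of functions asymptotic to `t ^ (α - 1) * log t ^ m` -/

/-- If `f` is asymptotic to a multiple of a positive derivative `G'` and `G` tends to infinity,
then the integral of `f` is asymptotic to the same multiple of `G`. -/
lemma tendsto_integral_div_of_tendsto_div {f g G : ℝ → ℝ} {a c : ℝ}
    (hf : ∀ x y, a ≤ x → x ≤ y → IntervalIntegrable f volume x y)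
    (hg : ∀ᶠ t in atTop, HasDerivAt G (g t) t ∧ ContinuousAt g t ∧ 0 < g t)
    (hG : Tendsto G atTop atTop) (hfg : Tendsto (fun t => f t / g t) atTop (𝓝 c)) :
    Tendsto (fun R => (∫ t in a..R, f t) / G R) atTop (𝓝 c) := by
  rw [Metric.tendsto_atTop']
  intro ε hε
  have hε2 : 0 < ε / 3 := by positivity
  have hclose : ∀ᶠ t in atTop, |f t / g t - c| < ε / 3 := by
    simpa [Real.dist_eq] using hfg.eventually (Metric.ball_mem_nhds c hε2)
  obtain ⟨b, hb⟩ := eventually_atTop.mp ((hg.and hclose).and (eventually_ge_atTop a))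
  set K := |(∫ t in a..b, f t) - c * G b| + ε / 3 * |G b| with hK
  have hlarge := (hG.eventually_gt_atTop 0).and (hG.eventually_ge_atTop (K / (ε / 3)))
  obtain ⟨b', hb'⟩ := eventually_atTop.mp hlarge
  refine ⟨max b b', fun R hR => ?_⟩
  have hRb : b ≤ R := (le_max_left _ _).trans hR.le
  obtain ⟨hGpos, hGK⟩ := hb' R ((le_max_right _ _).trans hR.le)
  have hab : a ≤ b := (hb b le_rfl).2
  have hgc : ContinuousOn g (Set.uIcc b R) := by
    intro t ht
    rw [Set.uIcc_of_le hRb] at ht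
    exact (hb t ht.1).1.1.2.1.continuousWithinAt
  have hgi : IntervalIntegrable g volume b R := hgc.intervalIntegrable
  have hgG : ∫ t in b..R, g t = G R - G b := by
    refine intervalIntegral.integral_eq_sub_of_hasDerivAt (fun t ht => ?_) hgi
    rw [Set.uIcc_of_le hRb] at ht
    exact (hb t ht.1).1.1.1
  have hfi := hf b R hab hRb
  have hdiff : |∫ t in b..R, (f t - c * g t)| ≤ ε / 3 * (G R - G b) := by
    rw [← hgG, ← intervalIntegral.integral_const_mul]
    refine intervalIntegral.norm_integral_le_of_norm_le (f := fun t => f t - c * g t) hRb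
      (Eventually.of_forall fun t ht => ?_) (hgi.const_mul _)
    obtain ⟨⟨⟨_, _, hpos⟩, hlt⟩, _⟩ := hb t ht.1.le
    rw [Real.norm_eq_abs]
    have h1 : f t - c * g t = (f t / g t - c) * g t := by field_simp
    rw [h1, abs_mul, abs_of_pos hpos]
    gcongr
  rw [intervalIntegral.integral_sub hfi (hgi.const_mul c), intervalIntegral.integral_const_mul,
    hgG] at hdiff
  rw [Real.dist_eq, ← intervalIntegral.integral_add_adjacent_intervals (hf a b le_rfl hab) hfi]
  have h2 : ((∫ t in a..b, f t) + ∫ t in b..R, f t) / G R - c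
      = (((∫ t in a..b, f t) - c * G b) + ((∫ t in b..R, f t) - c * (G R - G b))) / G R := by
    field_simp
    ring
  rw [h2, abs_div, abs_of_pos hGpos, div_lt_iff₀ hGpos]
  rw [div_le_iff₀ hε2] at hGK
  have h3 := abs_add_le ((∫ t in a..b, f t) - c * G b) ((∫ t in b..R, f t) - c * (G R - G b))
  have h4 : -(ε / 3 * G b) ≤ ε / 3 * |G b| := by
    rw [← mul_neg]
    gcongr
    exact neg_le_abs _
  have h5 : 0 < ε * G R := by positivity
  linarith

/-- If `f` is asymptotic to a multiple of `-G'` with `G' < 0` and `G` tends to zero, then the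
integral of `f` over `(R, ∞)` exists and is asymptotic to the same multiple of `G`. -/
lemma tendsto_integral_Ioi_div_of_tendsto_div {f g G : ℝ → ℝ} {c : ℝ} (hf : Measurable f)
    (hg : ∀ᶠ t in atTop, HasDerivAt G (-g t) t ∧ 0 < g t)
    (hG : Tendsto G atTop (𝓝 0)) (hfg : Tendsto (fun t => f t / g t) atTop (𝓝 c)) :
    (∀ᶠ R in atTop, IntegrableOn f (Set.Ioi R)) ∧
      Tendsto (fun R => (∫ t in Set.Ioi R, f t) / G R) atTop (𝓝 c) := by
  have main : ∀ ε > 0, ∀ᶠ R in atTop, IntegrableOn f (Set.Ioi R) ∧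
      |(∫ t in Set.Ioi R, f t) / G R - c| ≤ ε := by
    intro ε hε
    have hclose : ∀ᶠ t in atTop, |f t / g t - c| < ε := by
      simpa [Real.dist_eq] using hfg.eventually (Metric.ball_mem_nhds c hε)
    obtain ⟨b, hb⟩ := eventually_atTop.mp (hg.and hclose)
    filter_upwards [eventually_ge_atTop b] with R hR
    have hderiv : ∀ t ∈ Set.Ici R, HasDerivAt G (-g t) t := fun t ht =>
      (hb t (hR.trans ht)).1.1
    have hneg : ∀ t ∈ Set.Ioi R, -g t ≤ 0 := fun t ht =>
      neg_nonpos.mpr (hb t (hR.trans (le_of_lt ht))).1.2.le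
    have hgi : IntegrableOn g (Set.Ioi R) := by
      simpa using! (integrableOn_Ioi_deriv_of_nonpos' hderiv hneg hG).neg
    have hgG : ∫ t in Set.Ioi R, g t = G R := by
      have := integral_Ioi_of_hasDerivAt_of_nonpos' hderiv hneg hG
      rw [integral_neg] at this
      linarith
    have hbound : ∀ t ∈ Set.Ioi R, |f t - c * g t| ≤ ε * g t := by
      intro t ht
      obtain ⟨⟨_, hpos⟩, hlt⟩ := hb t (hR.trans (le_of_lt ht))
      have h1 : f t - c * g t = (f t / g t - c) * g t := by field_simp
      rw [h1, abs_mul, abs_of_pos hpos]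
      gcongr
    have hdi : IntegrableOn (fun t => f t - c * g t) (Set.Ioi R) := by
      refine Integrable.mono' (hgi.const_mul ε)
        (hf.aestronglyMeasurable.sub (hgi.const_mul c).aestronglyMeasurable) ?_
      exact (ae_restrict_iff' measurableSet_Ioi).mpr (Eventually.of_forall hbound)
    have hfi : IntegrableOn f (Set.Ioi R) := by
      have := hdi.add (hgi.const_mul c)
      refine this.congr (Eventually.of_forall fun t => ?_)
      simp
    refine ⟨hfi, ?_⟩
    have hGpos : 0 < G R := by
      rw [← hgG, setIntegral_pos_iff_support_of_nonneg_ae _ hgi]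
      · have : Set.Ioi R ⊆ Function.support g ∩ Set.Ioi R := fun t ht =>
          ⟨(hb t (hR.trans (le_of_lt ht))).1.2.ne', ht⟩
        refine lt_of_lt_of_le ?_ (measure_mono this)
        simp
      · exact (ae_restrict_iff' measurableSet_Ioi).mpr (Eventually.of_forall fun t ht =>
          (hb t (hR.trans (le_of_lt ht))).1.2.le)
    have h1 : |∫ t in Set.Ioi R, (f t - c * g t)| ≤ ε * G R := by
      rw [← hgG, ← integral_const_mul]
      exact norm_integral_le_of_norm_le (f := fun t => f t - c * g t) (hgi.const_mul ε)
        ((ae_restrict_iff' measurableSet_Ioi).mpr (Eventually.of_forall hbound))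
    rw [integral_sub hfi (hgi.const_mul c), integral_const_mul, hgG] at h1
    have h2 : (∫ t in Set.Ioi R, f t) / G R - c = ((∫ t in Set.Ioi R, f t) - c * G R) / G R := by
      field_simp
    rw [h2, abs_div, abs_of_pos hGpos, div_le_iff₀ hGpos]
    exact h1
  refine ⟨(main 1 one_pos).mono fun R h => h.1, ?_⟩
  rw [Metric.tendsto_nhds]
  intro ε hε
  filter_upwards [main (ε / 2) (by positivity)] with R h
  rw [Real.dist_eq]
  linarith [h.2]

lemma hasDerivAt_rpow_mul_log_pow (α : ℝ) (m : ℕ) {t : ℝ} (ht : 1 < t) :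
    HasDerivAt (fun t => t ^ α * Real.log t ^ m)
      (t ^ (α - 1) * Real.log t ^ m * (α + m / Real.log t)) t := by
  have h0 : t ≠ 0 := by positivity
  have hl : Real.log t ≠ 0 := (Real.log_pos ht).ne'
  have h := (Real.hasDerivAt_rpow_const (p := α) (Or.inl h0)).mul
    ((Real.hasDerivAt_log h0).pow m)
  refine h.congr_deriv ?_
  have h1 : t ^ α = t ^ (α - 1) * t := by
    rw [Real.rpow_sub_one h0]
    field_simp
  rw [h1]
  rcases m with _ | m
  · simp
    ring
  · simp only [Pi.pow_apply, Nat.add_sub_cancel]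
    field_simp
    ring

lemma tendsto_const_add_div_log (α β : ℝ) :
    Tendsto (fun t => α + β / Real.log t) atTop (𝓝 α) := by
  simpa using (Real.tendsto_log_atTop.const_div_atTop β).const_add α

lemma tendsto_rpow_mul_log_pow_atTop {α : ℝ} (hα : 0 < α) (m : ℕ) :
    Tendsto (fun t => t ^ α * Real.log t ^ m) atTop atTop := by
  refine tendsto_atTop_mono' atTop ?_ (tendsto_rpow_atTop hα)
  filter_upwards [eventually_gt_atTop 0, Real.tendsto_log_atTop.eventually_ge_atTop 1] with t h0 h1
  exact le_mul_of_one_le_right (by positivity) (one_le_pow₀ h1)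

lemma tendsto_rpow_mul_log_pow_zero {α : ℝ} (hα : α < 0) (m : ℕ) :
    Tendsto (fun t => t ^ α * Real.log t ^ m) atTop (𝓝 0) := by
  have h := (isLittleO_log_rpow_rpow_atTop (m : ℝ) (neg_pos.mpr hα)).tendsto_div_nhds_zero
  refine h.congr' ?_
  filter_upwards [eventually_gt_atTop 0] with t h0
  rw [Real.rpow_neg h0.le, Real.rpow_natCast, div_inv_eq_mul, mul_comm]

/-- The integral of a function asymptotic to `c * t ^ (α - 1) * log t ^ m`, where `0 < α`. -/
lemma tendsto_integral_div_rpow_mul_log_pow {f : ℝ → ℝ} {a c α : ℝ} (hα : 0 < α) (m : ℕ)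
    (hf : ∀ x y, a ≤ x → x ≤ y → IntervalIntegrable f volume x y)
    (h : Tendsto (fun t => f t / (t ^ (α - 1) * Real.log t ^ m)) atTop (𝓝 c)) :
    Tendsto (fun R => (∫ t in a..R, f t) / (R ^ α * Real.log R ^ m)) atTop (𝓝 (c / α)) := by
  refine tendsto_integral_div_of_tendsto_div
    (g := fun t => t ^ (α - 1) * Real.log t ^ m * (α + m / Real.log t)) hf ?_
    (tendsto_rpow_mul_log_pow_atTop hα m) ?_
  · filter_upwards [eventually_gt_atTop 1] with t ht
    have hl := Real.log_pos ht
    have h0 : t ≠ 0 := by positivity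
    refine ⟨hasDerivAt_rpow_mul_log_pow α m ht, ?_, by positivity⟩
    have h1 : ContinuousAt (fun t : ℝ => t ^ (α - 1)) t :=
      Real.continuousAt_rpow_const _ _ (Or.inl h0)
    have h2 : ContinuousAt Real.log t := Real.continuousAt_log h0
    exact (h1.mul (h2.pow m)).mul (continuousAt_const.add (continuousAt_const.div h2 hl.ne'))
  · have := h.div (tendsto_const_add_div_log α m) hα.ne'
    refine this.congr fun t => ?_
    rw [Pi.div_apply, div_div]

/-- The tail integral of a function asymptotic to `c * t ^ (α - 1) * log t ^ m`, where `α < 0`. -/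
lemma tendsto_integral_Ioi_div_rpow_mul_log_pow {f : ℝ → ℝ} {c α : ℝ} (hα : α < 0) (m : ℕ)
    (hf : Measurable f)
    (h : Tendsto (fun t => f t / (t ^ (α - 1) * Real.log t ^ m)) atTop (𝓝 c)) :
    (∀ᶠ R in atTop, IntegrableOn f (Set.Ioi R)) ∧
      Tendsto (fun R => (∫ t in Set.Ioi R, f t) / (R ^ α * Real.log R ^ m)) atTop
        (𝓝 (c / -α)) := by
  have hlim := (tendsto_const_add_div_log α m).neg
  refine tendsto_integral_Ioi_div_of_tendsto_div
    (g := fun t => t ^ (α - 1) * Real.log t ^ m * -(α + m / Real.log t)) hf ?_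
    (tendsto_rpow_mul_log_pow_zero hα m) ?_
  · filter_upwards [eventually_gt_atTop 1, hlim.eventually_const_lt (neg_pos.mpr hα)] with t ht h1
    have hl := Real.log_pos ht
    refine ⟨?_, mul_pos (by positivity) h1⟩
    rw [mul_neg, neg_neg]
    exact hasDerivAt_rpow_mul_log_pow α m ht
  · have := h.div hlim (neg_ne_zero.mpr hα.ne)
    refine this.congr fun t => ?_
    rw [Pi.div_apply, div_div]

/-- The integral of a function asymptotic to `c * log t ^ m / t`. -/
lemma tendsto_integral_div_log_pow {f : ℝ → ℝ} {a c : ℝ} (m : ℕ)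
    (hf : ∀ x y, a ≤ x → x ≤ y → IntervalIntegrable f volume x y)
    (h : Tendsto (fun t => f t / (Real.log t ^ m / t)) atTop (𝓝 c)) :
    Tendsto (fun R => (∫ t in a..R, f t) / Real.log R ^ (m + 1)) atTop (𝓝 (c / (m + 1))) := by
  refine tendsto_integral_div_of_tendsto_div
    (g := fun t => (m + 1) * (Real.log t ^ m / t)) hf ?_
    ((tendsto_pow_atTop m.succ_ne_zero).comp Real.tendsto_log_atTop) ?_
  · filter_upwards [eventually_gt_atTop 1] with t ht
    have hl := Real.log_pos ht
    have h0 : t ≠ 0 := by positivity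
    refine ⟨?_, ?_, by positivity⟩
    · refine ((Real.hasDerivAt_log h0).pow (m + 1)).congr_deriv ?_
      simp only [Nat.cast_add, Nat.cast_one, Nat.add_sub_cancel]
      ring
    · exact continuousAt_const.mul (((Real.continuousAt_log h0).pow m).div continuousAt_id h0)
  · have := h.div_const ((m : ℝ) + 1)
    refine this.congr fun t => ?_
    rw [div_div, mul_comm]

/-! ### Counting lattice points below a level -/

/-- The number of indices at which `v` is at most `t`. It is only used for `v` with finite
sublevel sets. -/
noncomputable def count {ι : Type*} (v : ι → ℝ) (t : ℝ) : ℕ := {k | v k ≤ t}.ncard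

section Count

variable {ι κ : Type*} {u : ι → ℝ} {v : κ → ℝ}

lemma count_eq_card (hv : ∀ t, {k | v k ≤ t}.Finite) (t : ℝ) :
    count v t = (hv t).toFinset.card := Set.ncard_eq_toFinset_card _ (hv t)

lemma count_monotone (hv : ∀ t, {k | v k ≤ t}.Finite) : Monotone fun t => (count v t : ℝ) := by
  intro a b hab
  have : count v a ≤ count v b :=
    Set.ncard_le_ncard (fun k (hk : v k ≤ a) => hk.trans hab) (hv b)
  exact Nat.cast_le.mpr this

lemma count_comp_equiv (e : ι ≃ κ) (t : ℝ) : count (v ∘ e) t = count v t :=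
  Set.ncard_preimage_of_injective_subset_range e.injective (s := {k | v k ≤ t}) (by simp)

lemma cast_count_eq_sum (hv : ∀ t, {k | v k ≤ t}.Finite) {t R : ℝ} (htR : t ≤ R) :
    (count v t : ℝ) = ∑ k ∈ (hv R).toFinset, if v k ≤ t then 1 else 0 := by
  rw [count_eq_card hv, Finset.sum_ite, Finset.sum_const_zero, add_zero, Finset.sum_const,
    nsmul_eq_mul, mul_one]
  congr 2
  ext k
  simp only [Set.Finite.mem_toFinset, Set.mem_ofPred_eq, Finset.mem_filter]
  exact ⟨fun h => ⟨h.trans htR, h⟩, fun h => h.2⟩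

lemma setIntegral_ite_le (s : Set ℝ) (a : ℝ) (p : ℝ → ℝ) :
    ∫ t in s, (if a ≤ t then p t else 0) = ∫ t in s ∩ Set.Ioi a, p t := by
  have h1 : (fun t => if a ≤ t then p t else 0) = (Set.Ici a).indicator p := by
    ext t
    simp [Set.indicator_apply]
  rw [h1, setIntegral_indicator measurableSet_Ici]
  exact setIntegral_congr_set ((ae_eq_refl s).inter Ioi_ae_eq_Ici.symm)

/-- Summation by parts. -/
lemma sum_integral_eq (hv : ∀ t, {k | v k ≤ t}.Finite) (hv1 : ∀ k, 1 ≤ v k) {p : ℝ → ℝ} {R : ℝ}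
    (hR : 1 ≤ R) (hp : ContinuousOn p (Set.Icc 1 R)) :
    ∑ k ∈ (hv R).toFinset, ∫ t in v k..R, p t = ∫ t in 1..R, count v t * p t := by
  have hpi : IntegrableOn p (Set.Ioc 1 R) :=
    (hp.integrableOn_Icc).mono_set Set.Ioc_subset_Icc_self
  have h1 : ∫ t in 1..R, count v t * p t
      = ∫ t in Set.Ioc 1 R, ∑ k ∈ (hv R).toFinset, if v k ≤ t then p t else 0 := by
    rw [intervalIntegral.integral_of_le hR]
    refine setIntegral_congr_fun measurableSet_Ioc fun t ht => ?_
    simp only [cast_count_eq_sum hv ht.2, Finset.sum_mul, ite_mul, one_mul, zero_mul]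
  rw [h1, integral_finsetSum]
  · refine Finset.sum_congr rfl fun k hk => ?_
    have hkR : v k ≤ R := by simpa using hk
    rw [setIntegral_ite_le, intervalIntegral.integral_of_le hkR, Set.Ioc_inter_Ioi,
      max_eq_right (hv1 k)]
  · intro k _
    have h2 : (fun t => if v k ≤ t then p t else 0) = (Set.Ici (v k)).indicator p := by
      ext t
      simp [Set.indicator_apply]
    rw [h2]
    exact Integrable.indicator hpi measurableSet_Ici

lemma intervalIntegrable_count_mul (hv : ∀ t, {k | v k ≤ t}.Finite) {p : ℝ → ℝ}
    (hp : ContinuousOn p (Set.Ici 1)) (x y : ℝ) (hx : 1 ≤ x) (hxy : x ≤ y) :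
    IntervalIntegrable (fun t => count v t * p t) volume x y := by
  refine ((count_monotone hv).intervalIntegrable).mul_continuousOn (hp.mono ?_)
  rw [Set.uIcc_of_le hxy]
  exact fun t ht => hx.trans ht.1

/-- If `v` has about `C * t * log t ^ m` values below `t`, then the reciprocals of the values
below `R` add up to about `C / (m + 1) * log R ^ (m + 1)`. -/
lemma tendsto_sum_inv_div_log_pow (hv : ∀ t, {k | v k ≤ t}.Finite) (hv1 : ∀ k, 1 ≤ v k) {C : ℝ}
    {m : ℕ} (h : Tendsto (fun t => count v t / (t * Real.log t ^ m)) atTop (𝓝 C)) :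
    Tendsto (fun R => (∑ k ∈ (hv R).toFinset, (v k)⁻¹) / Real.log R ^ (m + 1)) atTop
      (𝓝 (C / (m + 1))) := by
  have hpc : ContinuousOn (fun t : ℝ => (t ^ 2)⁻¹) (Set.Ici 1) := by
    refine ContinuousOn.inv₀ (by fun_prop) fun t ht => ?_
    have : (0 : ℝ) < t := zero_lt_one.trans_le ht
    positivity
  have hI := tendsto_integral_div_log_pow m (intervalIntegrable_count_mul hv hpc)
    (c := C) (h.congr' (by
      filter_upwards [eventually_gt_atTop 1] with t ht
      have hl := (Real.log_pos ht).ne'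
      have h0 : t ≠ 0 := by positivity
      field_simp))
  have hB := h.mul (Real.tendsto_log_atTop.inv_tendsto_atTop)
  have hsum := hI.add hB
  rw [mul_zero, add_zero] at hsum
  refine hsum.congr' ?_
  filter_upwards [eventually_gt_atTop 1] with R hR
  have hl := (Real.log_pos hR).ne'
  have h0 : R ≠ 0 := by positivity
  have hint : ∀ k ∈ (hv R).toFinset, ∫ t in v k..R, (t ^ 2)⁻¹ = (v k)⁻¹ - R⁻¹ := by
    intro k hk
    have hkR : v k ≤ R := by simpa using hk
    have hpos : ∀ t ∈ Set.uIcc (v k) R, (0 : ℝ) < t := by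
      intro t ht
      rw [Set.uIcc_of_le hkR] at ht
      exact zero_lt_one.trans_le ((hv1 k).trans ht.1)
    rw [intervalIntegral.integral_eq_sub_of_hasDerivAt (f := fun t => -t⁻¹)]
    · ring
    · intro t ht
      exact (hasDerivAt_inv (hpos t ht).ne').neg.congr_deriv (neg_neg _)
    · refine ContinuousOn.intervalIntegrable (ContinuousOn.inv₀ (by fun_prop) fun t ht => ?_)
      have := hpos t ht
      positivity
  have hparts := sum_integral_eq hv hv1 hR.le (hpc.mono fun t ht => ht.1)
  rw [Finset.sum_congr rfl hint, Finset.sum_sub_distrib, Finset.sum_const, nsmul_eq_mul,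
    ← count_eq_card hv] at hparts
  rw [sub_eq_iff_eq_add] at hparts
  rw [hparts, Pi.inv_apply]
  field_simp
  ring

lemma finite_prod_le (hu : ∀ t, {i | u i ≤ t}.Finite) (hv : ∀ t, {k | v k ≤ t}.Finite)
    (hu1 : ∀ i, 1 ≤ u i) (hv1 : ∀ k, 1 ≤ v k) (t : ℝ) :
    {x : ι × κ | u x.1 * v x.2 ≤ t}.Finite := by
  refine ((hu t).prod (hv t)).subset fun x (hx : u x.1 * v x.2 ≤ t) => ?_
  have h1 := hu1 x.1
  have h2 := hv1 x.2
  constructor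
  · exact (le_mul_of_one_le_right (by linarith) h2).trans hx
  · exact (le_mul_of_one_le_left (by linarith) h1).trans hx

lemma count_prod (hu : ∀ t, {i | u i ≤ t}.Finite) (hv : ∀ t, {k | v k ≤ t}.Finite)
    (hu1 : ∀ i, 1 ≤ u i) (hv1 : ∀ k, 1 ≤ v k) (R : ℝ) :
    count (fun x : ι × κ => u x.1 * v x.2) R
      = ∑ k ∈ (hv R).toFinset, count u (R / v k) := by
  classical
  have hfin := finite_prod_le hu hv hu1 hv1
  rw [count_eq_card hfin, Finset.card_eq_sum_card_fiberwise (f := Prod.snd)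
    (t := (hv R).toFinset)]
  · refine Finset.sum_congr rfl fun k _ => ?_
    have hk : 0 < v k := zero_lt_one.trans_le (hv1 k)
    rw [count_eq_card hu]
    refine Finset.card_nbij' Prod.fst (fun i => (i, k)) ?_ ?_ ?_ ?_
    · rintro ⟨i, j⟩ h
      simp only [Finset.coe_filter, Set.Finite.mem_toFinset, Set.mem_ofPred_eq] at h
      obtain ⟨h, rfl⟩ := h
      simpa [le_div_iff₀ hk] using h
    · intro i h
      simpa [le_div_iff₀ hk] using h
    · rintro ⟨i, j⟩ h
      simp only [Finset.coe_filter, Set.Finite.mem_toFinset, Set.mem_ofPred_eq] at h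
      rw [h.2]
    · intro i _
      rfl
  · intro x hx
    have hx' : u x.1 * v x.2 ≤ R := by simpa using hx
    have h1 := hu1 x.1
    have h2 := hv1 x.2
    simpa using (le_mul_of_one_le_left (by linarith) h1).trans hx'

lemma exists_abs_count_sub_le (hu : ∀ t, {i | u i ≤ t}.Finite) {c : ℝ}
    (h : Tendsto (fun t => count u t / t) atTop (𝓝 c)) {ε : ℝ} (hε : 0 < ε) :
    ∃ K, ∀ x, 1 ≤ x → |count u x - c * x| ≤ ε * x + K := by
  have hclose : ∀ᶠ t in atTop, |count u t / t - c| < ε := by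
    simpa [Real.dist_eq] using h.eventually (Metric.ball_mem_nhds c hε)
  obtain ⟨b, hb⟩ := eventually_atTop.mp hclose
  refine ⟨count u b + |c| * |b|, fun x hx => ?_⟩
  have hx0 : 0 < x := zero_lt_one.trans_le hx
  rcases le_total b x with hbx | hbx
  · have h1 := hb x hbx
    have h2 : (count u x : ℝ) - c * x = (count u x / x - c) * x := by field_simp
    rw [h2, abs_mul, abs_of_pos hx0]
    have h3 : |count u x / x - c| * x ≤ ε * x := by gcongr
    have h4 : 0 ≤ (count u b : ℝ) + |c| * |b| := by positivity
    linarith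
  · have h1 : (count u x : ℝ) ≤ count u b := count_monotone hu hbx
    have h2 := abs_sub (count u x : ℝ) (c * x)
    rw [Nat.abs_cast, abs_mul, abs_of_pos hx0] at h2
    have h3 : |c| * x ≤ |c| * |b| := by
      gcongr
      exact hbx.trans (le_abs_self b)
    have h4 : 0 ≤ ε * x := by positivity
    linarith

/-- The counting function of a product weight, one of whose factors has about `c * t` values
below `t`: it is the sum of `count u (R / v k)` over `k`, hence about `c * R` times the sum of
the `1 / v k`. -/
lemma tendsto_count_prod (hu : ∀ t, {i | u i ≤ t}.Finite) (hv : ∀ t, {k | v k ≤ t}.Finite)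
    (hu1 : ∀ i, 1 ≤ u i) (hv1 : ∀ k, 1 ≤ v k) {c C : ℝ} {m : ℕ}
    (hcu : Tendsto (fun t => count u t / t) atTop (𝓝 c))
    (hcv : Tendsto (fun t => count v t / (t * Real.log t ^ m)) atTop (𝓝 C)) :
    Tendsto (fun R => count (fun x : ι × κ => u x.1 * v x.2) R / (R * Real.log R ^ (m + 1)))
      atTop (𝓝 (c * (C / (m + 1)))) := by
  set B : ℝ → ℝ := fun R => (∑ k ∈ (hv R).toFinset, (v k)⁻¹) / Real.log R ^ (m + 1) with hB
  have hBlim : Tendsto B atTop (𝓝 (C / (m + 1))) := tendsto_sum_inv_div_log_pow hv hv1 hcv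
  set h : ℝ → ℝ := fun R => count v R / (R * Real.log R ^ m) * (Real.log R)⁻¹ with hh
  have hhlim : Tendsto h atTop (𝓝 0) := by
    have := hcv.mul (Real.tendsto_log_atTop.inv_tendsto_atTop)
    rwa [mul_zero] at this
  set X : ℝ → ℝ := fun R =>
    count (fun x : ι × κ => u x.1 * v x.2) R / (R * Real.log R ^ (m + 1)) with hX
  have hbound : ∀ ε > 0, ∃ K, ∀ R, 1 < R → |X R - c * B R| ≤ ε * B R + K * h R := by
    intro ε hε
    obtain ⟨K, hK⟩ := exists_abs_count_sub_le hu hcu hε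
    refine ⟨K, fun R hR => ?_⟩
    have hl := Real.log_pos hR
    have hR0 : 0 < R := zero_lt_one.trans hR
    have h1 : |∑ k ∈ (hv R).toFinset, ((count u (R / v k) : ℝ) - c * (R / v k))|
        ≤ ∑ k ∈ (hv R).toFinset, (ε * (R / v k) + K) := by
      refine (Finset.abs_sum_le_sum_abs _ _).trans (Finset.sum_le_sum fun k hk => hK _ ?_)
      have hkR : v k ≤ R := by simpa using hk
      rwa [le_div_iff₀ (zero_lt_one.trans_le (hv1 k)), one_mul]
    rw [Finset.sum_sub_distrib, Finset.sum_add_distrib, ← Nat.cast_sum,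
      ← count_prod hu hv hu1 hv1, Finset.sum_const, nsmul_eq_mul, ← count_eq_card hv] at h1
    simp only [div_eq_mul_inv R, ← Finset.mul_sum] at h1
    have hden : 0 < R * Real.log R ^ (m + 1) := by positivity
    have h2 : X R - c * B R = ((count (fun x : ι × κ => u x.1 * v x.2) R : ℝ)
        - c * (R * ∑ k ∈ (hv R).toFinset, (v k)⁻¹)) / (R * Real.log R ^ (m + 1)) := by
      simp only [hX, hB]
      field_simp
    have h3 : ε * B R + K * h R = (ε * (R * ∑ k ∈ (hv R).toFinset, (v k)⁻¹) + count v R * K)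
        / (R * Real.log R ^ (m + 1)) := by
      simp only [hB, hh]
      field_simp
      ring
    rw [h2, h3, abs_div, abs_of_pos hden]
    gcongr
  have hdiff : Tendsto (fun R => X R - c * B R) atTop (𝓝 0) := by
    rw [Metric.tendsto_nhds]
    intro ε hε
    -- `b` bounds the normalized sums of reciprocals
    set b := |C / (m + 1)| + 1 with hb
    have hbpos : 0 < b := by positivity
    obtain ⟨K, hK⟩ := hbound (ε / (2 * b)) (by positivity)
    have hlim : Tendsto (fun R => ε / (2 * b) * B R + K * h R) atTop
        (𝓝 (ε / (2 * b) * (C / (m + 1)) + K * 0)) :=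
      (hBlim.const_mul _).add (hhlim.const_mul K)
    have hlt : ε / (2 * b) * (C / (m + 1)) + K * 0 < ε := by
      have h1 : C / (m + 1) < b := (le_abs_self _).trans_lt (lt_add_one _)
      have h2 : ε / (2 * b) * (C / (m + 1)) < ε / (2 * b) * b := by gcongr
      have h3 : ε / (2 * b) * b = ε / 2 := by field_simp
      linarith
    filter_upwards [hlim.eventually_lt_const hlt, eventually_gt_atTop 1] with R h1 h2
    rw [Real.dist_eq, sub_zero]
    exact (hK R h2).trans_lt h1
  have := hdiff.add (hBlim.const_mul c)
  rw [zero_add] at this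
  refine this.congr fun R => ?_
  ring

end Count

/-- The number of integers `k` with `|k| ≤ x R` is asymptotic to `2 * R` if `x R` is to `R`. -/
lemma tendsto_count_div_of_abs_le_iff {w : ℤ → ℝ} {x : ℝ → ℝ}
    (hx : ∀ R, 1 ≤ R → ∀ k : ℤ, w k ≤ R ↔ |(k : ℝ)| ≤ x R) (hx0 : ∀ R, 1 ≤ R → 0 ≤ x R)
    (hlim : Tendsto (fun R => x R / R) atTop (𝓝 1)) :
    Tendsto (fun R => count w R / R) atTop (𝓝 2) := by
  have hcount : ∀ R, 1 ≤ R → (count w R : ℝ) = 2 * ⌊x R⌋₊ + 1 := by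
    intro R hR
    have h1 : {k : ℤ | w k ≤ R} = (Finset.Icc (-(⌊x R⌋₊ : ℤ)) ⌊x R⌋₊ : Finset ℤ) := by
      ext k
      simp only [Set.mem_ofPred_eq, Finset.coe_Icc, Set.mem_Icc]
      rw [hx R hR k, ← abs_le, ← Int.cast_abs, Int.natCast_floor_eq_floor (hx0 R hR), Int.le_floor]
    rw [count, h1, Set.ncard_coe_finset, Int.card_Icc]
    have : ((⌊x R⌋₊ : ℤ) + 1 - -(⌊x R⌋₊ : ℤ)).toNat = 2 * ⌊x R⌋₊ + 1 := by lia
    rw [this]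
    push_cast
    ring
  have hlow : Tendsto (fun R : ℝ => 2 * (x R / R) - 1 / R) atTop (𝓝 2) := by
    have := (hlim.const_mul 2).sub (tendsto_const_nhds (x := (1 : ℝ)).div_atTop tendsto_id)
    simpa using this
  have hup : Tendsto (fun R : ℝ => 2 * (x R / R) + 1 / R) atTop (𝓝 2) := by
    have := (hlim.const_mul 2).add (tendsto_const_nhds (x := (1 : ℝ)).div_atTop tendsto_id)
    simpa using this
  refine tendsto_of_tendsto_of_tendsto_of_le_of_le' hlow hup ?_ ?_
  all_goals
    filter_upwards [eventually_ge_atTop 1] with R hR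
    have hR0 : 0 < R := zero_lt_one.trans_le hR
    rw [hcount R hR]
    have h1 := Nat.floor_le (hx0 R hR)
    have h2 := Nat.lt_floor_add_one (x R)
    rw [← mul_div_assoc]
  · rw [← sub_div]
    gcongr
    linarith
  · rw [← add_div]
    gcongr

/-- The leading constant of the counting function in dimension `m + 1` is
`2 ^ (m + 1) / m !`. -/
lemma tendsto_count_prod_fin {w : ℤ → ℝ} (hw : ∀ t, {k | w k ≤ t}.Finite) (hw1 : ∀ k, 1 ≤ w k)
    (hlim : Tendsto (fun t => count w t / t) atTop (𝓝 2)) (m : ℕ) :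
    (∀ t, {k : Fin (m + 1) → ℤ | ∏ i, w (k i) ≤ t}.Finite) ∧
      Tendsto (fun t => count (fun k : Fin (m + 1) → ℤ => ∏ i, w (k i)) t
        / (t * Real.log t ^ m)) atTop (𝓝 (2 ^ (m + 1) / (m ! : ℝ))) := by
  induction m with
  | zero =>
    let e : (Fin 1 → ℤ) ≃ ℤ := Equiv.funUnique (Fin 1) ℤ
    have he : (fun k : Fin 1 → ℤ => ∏ i, w (k i)) = w ∘ e := by
      ext k
      simp [e]
    refine ⟨fun t => ?_, ?_⟩
    · exact Set.Finite.preimage (e.injective.injOn) (hw t) |>.subset fun k hk => by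
        simpa [e] using hk
    · simp only [Nat.reduceAdd] at he ⊢
      rw [he]
      simpa [count_comp_equiv] using hlim
  | succ m ih =>
    obtain ⟨hfin, hih⟩ := ih
    have hv1 : ∀ k : Fin (m + 1) → ℤ, 1 ≤ ∏ i, w (k i) := fun k =>
      Finset.one_le_prod fun i _ => hw1 (k i)
    let e : (Fin (m + 2) → ℤ) ≃ ℤ × (Fin (m + 1) → ℤ) := (Fin.consEquiv fun _ => ℤ).symm
    have he : (fun k : Fin (m + 2) → ℤ => ∏ i, w (k i))
        = (fun x : ℤ × (Fin (m + 1) → ℤ) => w x.1 * ∏ i, w (x.2 i)) ∘ e := by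
      ext k
      simp [e, Fin.prod_univ_succ (n := m + 1), Fin.consEquiv, Fin.tail]
    refine ⟨fun t => ?_, ?_⟩
    · have := Set.Finite.preimage (e.injective.injOn)
        (finite_prod_le hw hfin hw1 hv1 t)
      refine this.subset fun k (hk : ∏ i, w (k i) ≤ t) => ?_
      rw [congrFun he k] at hk
      exact hk
    · have h := tendsto_count_prod hw hfin hw1 hv1 hlim hih
      have hconst : (2 : ℝ) * (2 ^ (m + 1) / (m ! : ℝ) / (m + 1))
          = 2 ^ (m + 1 + 1) / ((m + 1)! : ℝ) := by
        rw [Nat.factorial_succ]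
        push_cast
        have : (m ! : ℝ) ≠ 0 := by positivity
        field_simp
        ring
      rw [hconst] at h
      refine h.congr fun t => ?_
      rw [he, count_comp_equiv]

/-! ### The sums that determine the widths -/

section Sums

variable {ι : Type*} {v : ι → ℝ}

lemma clip_rpow_div_rpow {s x R : ℝ} (hx : 0 < x) (hR : 0 < R) :
    clip (x ^ s / R ^ s) = min 1 ((x / R) ^ (2 * s)) := by
  rw [clip, ← Real.div_rpow hx.le hR.le, ← Real.rpow_natCast, ← Real.rpow_mul (by positivity)]
  congr 2
  push_cast
  ring

lemma clip_of_ge {s x R : ℝ} (hs : 0 < s) (hR : 0 < R) (h : R ≤ x) :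
    clip (x ^ s / R ^ s) = 1 := by
  rw [clip_rpow_div_rpow (hR.trans_le h) hR, min_eq_left]
  refine Real.one_le_rpow ?_ (by positivity)
  rwa [one_le_div hR]

lemma clip_of_le {s x R : ℝ} (hs : 0 < s) (hx : 0 < x) (h : x ≤ R) :
    clip (x ^ s / R ^ s) = (x / R) ^ (2 * s) := by
  have hR := hx.trans_le h
  rw [clip_rpow_div_rpow hx hR, min_eq_right]
  refine Real.rpow_le_one (by positivity) ?_ (by positivity)
  rwa [div_le_one hR]

/-- The sum of `1 - clip (v k ^ s / R ^ s)` over all `k`, which decides whether the width is below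
or above the value that belongs to the threshold `R`. -/
noncomputable def cutSum (hv : ∀ t, {k | v k ≤ t}.Finite) (s R : ℝ) : ℝ :=
  ∑ k ∈ (hv R).toFinset, (1 - clip (v k ^ s / R ^ s))

lemma hasSum_cutSum (hv : ∀ t, {k | v k ≤ t}.Finite) {s R : ℝ} (hs : 0 < s) (hR : 0 < R) :
    HasSum (fun k => 1 - clip (v k ^ s / R ^ s)) (cutSum hv s R) := by
  refine hasSum_sum_of_ne_finset_zero fun k hk => ?_
  have hk : R < v k := by simpa using hk
  rw [clip_of_ge hs hR hk.le, sub_self]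

lemma cutSum_mul_rpow (hv : ∀ t, {k | v k ≤ t}.Finite) (hv1 : ∀ k, 1 ≤ v k) {s R : ℝ}
    (hs : 0 < s) (hR : 1 ≤ R) :
    cutSum hv s R * R ^ (2 * s) = ∫ t in 1..R, count v t * (2 * s * t ^ (2 * s - 1)) := by
  have hR0 : 0 < R := zero_lt_one.trans_le hR
  rw [← sum_integral_eq hv hv1 hR, cutSum, Finset.sum_mul]
  · refine Finset.sum_congr rfl fun k hk => ?_
    have hkR : v k ≤ R := by simpa using hk
    have hk0 : 0 < v k := zero_lt_one.trans_le (hv1 k)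
    rw [clip_of_le hs hk0 hkR, intervalIntegral.integral_const_mul, integral_rpow (by
      left; linarith), Real.div_rpow hk0.le hR0.le]
    have : R ^ (2 * s) ≠ 0 := by positivity
    simp only [sub_add_cancel]
    field_simp
  · refine continuousOn_const.mul (ContinuousOn.rpow_const continuousOn_id fun t ht => Or.inl ?_)
    exact (zero_lt_one.trans_le ht.1).ne'

lemma tendsto_cutSum (hv : ∀ t, {k | v k ≤ t}.Finite) (hv1 : ∀ k, 1 ≤ v k) {s C : ℝ} {m : ℕ}
    (hs : 0 < s) (h : Tendsto (fun t => count v t / (t * Real.log t ^ m)) atTop (𝓝 C)) :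
    Tendsto (fun R => cutSum hv s R / (R * Real.log R ^ m)) atTop
      (𝓝 (C * (2 * s) / (2 * s + 1))) := by
  have hpc : ContinuousOn (fun t : ℝ => 2 * s * t ^ (2 * s - 1)) (Set.Ici 1) :=
    continuousOn_const.mul (ContinuousOn.rpow_const continuousOn_id fun t ht =>
      Or.inl (zero_lt_one.trans_le ht).ne')
  have hI := tendsto_integral_div_rpow_mul_log_pow (α := 2 * s + 1) (c := C * (2 * s))
    (by positivity) m (intervalIntegrable_count_mul hv hpc) ((h.mul_const (2 * s)).congr' (by
      filter_upwards [eventually_gt_atTop 1] with t ht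
      have hl := Real.log_pos ht
      have h0 : 0 < t := by positivity
      have h1 : t ^ (2 * s) = t ^ (2 * s - 1) * t := by
        rw [Real.rpow_sub_one h0.ne']
        field_simp
      rw [add_sub_cancel_right, h1]
      have : t ^ (2 * s - 1) ≠ 0 := by positivity
      field_simp))
  refine hI.congr' ?_
  filter_upwards [eventually_gt_atTop 1] with R hR
  have h0 : 0 < R := by positivity
  rw [← cutSum_mul_rpow hv hv1 hs hR.le, Real.rpow_add_one h0.ne']
  have : R ^ (2 * s) ≠ 0 := by positivity
  field_simp

lemma hasSum_of_tsum_ofReal_eq {a : ι → ℝ} {I : ℝ} (ha : ∀ k, 0 ≤ a k) (hI : 0 ≤ I)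
    (h : ∑' k, ENNReal.ofReal (a k) = ENNReal.ofReal I) : HasSum a I := by
  have hs : Summable a := by
    have := ENNReal.summable_toReal (f := fun k => ENNReal.ofReal (a k))
      (by rw [h]; exact ENNReal.ofReal_ne_top)
    exact this.congr fun k => ENNReal.toReal_ofReal (ha k)
  rw [← ENNReal.ofReal_tsum_of_nonneg ha hs,
    ENNReal.ofReal_eq_ofReal_iff (tsum_nonneg ha) hI] at h
  rw [← h]
  exact hs.hasSum

/-- Summation by parts for an infinite sum. -/
lemma hasSum_max_rpow_neg [Countable ι] (hv : ∀ t, {k | v k ≤ t}.Finite) {β R : ℝ}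
    (hβ : 0 < β) (hR : 0 < R)
    (hint : IntegrableOn (fun t => count v t * (β * t ^ (-β - 1))) (Set.Ioi R)) :
    HasSum (fun k => max R (v k) ^ (-β))
      (∫ t in Set.Ioi R, count v t * (β * t ^ (-β - 1))) := by
  set p : ℝ → ℝ := fun t => β * t ^ (-β - 1) with hp
  have hp0 : ∀ t ∈ Set.Ioi R, 0 ≤ p t := fun t ht => by
    have : 0 < t := hR.trans ht
    positivity
  have hpm : Measurable p := by fun_prop
  have htail : ∀ k, IntegrableOn p (Set.Ioi (max R (v k))) ∧
      ∫ t in Set.Ioi (max R (v k)), p t = max R (v k) ^ (-β) := by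
    intro k
    have hpos : 0 < max R (v k) := hR.trans_le (le_max_left _ _)
    refine ⟨(integrableOn_Ioi_rpow_of_lt (by linarith) hpos).const_mul β, ?_⟩
    rw [integral_const_mul, integral_Ioi_rpow_of_lt (by linarith) hpos]
    simp only [sub_add_cancel]
    field_simp
  refine hasSum_of_tsum_ofReal_eq (fun k => ?_) ?_ ?_
  · exact Real.rpow_nonneg (hR.le.trans (le_max_left _ _)) _
  · exact setIntegral_nonneg measurableSet_Ioi fun t ht =>
      mul_nonneg (Nat.cast_nonneg _) (hp0 t ht)
  · have h1 : ∀ k, ENNReal.ofReal (max R (v k) ^ (-β))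
        = ∫⁻ t in Set.Ioi R, (Set.Ioi (v k)).indicator (fun t => ENNReal.ofReal (p t)) t := by
      intro k
      rw [← (htail k).2, ofReal_integral_eq_lintegral_ofReal (htail k).1
        ((ae_restrict_iff' measurableSet_Ioi).mpr (Eventually.of_forall fun t ht =>
          hp0 t ((le_max_left R (v k)).trans_lt ht))),
        setLIntegral_indicator measurableSet_Ioi, Set.Ioi_inter_Ioi, sup_comm]
    simp_rw [h1]
    rw [← lintegral_tsum fun k =>
      ((hpm.ennreal_ofReal).indicator measurableSet_Ioi).aemeasurable,
      ofReal_integral_eq_lintegral_ofReal hint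
        ((ae_restrict_iff' measurableSet_Ioi).mpr (Eventually.of_forall fun t ht =>
          mul_nonneg (Nat.cast_nonneg _) (hp0 t ht)))]
    -- the two integrands differ only on the countable set of values of `v`
    have hnull : ∀ᵐ t ∂(volume.restrict (Set.Ioi R)), t ∉ Set.range v :=
      ae_restrict_of_ae ((Set.countable_range v).ae_notMem volume)
    refine lintegral_congr_ae ?_
    filter_upwards [hnull] with t ht
    rw [tsum_eq_sum (s := (hv t).toFinset)]
    · rw [ENNReal.ofReal_mul (Nat.cast_nonneg _), ENNReal.ofReal_natCast, count_eq_card hv,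
        ← nsmul_eq_mul]
      refine Finset.sum_eq_card_nsmul fun k hk => ?_
      have hk : v k ≤ t := by simpa using hk
      have hne : v k ≠ t := fun h => ht ⟨k, h⟩
      rw [Set.indicator_of_mem (Set.mem_Ioi.mpr (lt_of_le_of_ne hk hne))]
    · intro k hk
      have hk : t < v k := by simpa using hk
      exact Set.indicator_of_notMem (fun h => lt_asymm hk h) _

lemma clip_div_sq_eq {s x R : ℝ} (hs : 0 < s) (hx : 0 < x) (hR : 0 < R) :
    (clip (x ^ s / R ^ s) / x ^ s) ^ 2
      = max R x ^ (-(2 * s)) - R ^ (-(2 * s)) * (1 - clip (x ^ s / R ^ s)) := by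
  have hsq : ∀ y : ℝ, 0 < y → y ^ (2 * s) = (y ^ s) ^ 2 := fun y hy => by
    rw [← Real.rpow_natCast, ← Real.rpow_mul hy.le]
    congr 1
    push_cast
    ring
  rcases le_total R x with h | h
  · rw [clip_of_ge hs hR h, max_eq_right h, Real.rpow_neg hx.le, hsq x hx]
    ring
  · have hxs : x ^ s ≠ 0 := by positivity
    have hRs : R ^ s ≠ 0 := by positivity
    rw [clip_of_le hs hx h, max_eq_left h, Real.rpow_neg hR.le, Real.div_rpow hx.le hR.le,
      hsq x hx, hsq R hR]
    field_simp
    ring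

/-- The sum of the `(clip (v k ^ s / R ^ s) / v k ^ s) ^ 2`, the square of the width in the Wiener
algebra that belongs to the threshold `R`, is asymptotic to a multiple of
`R ^ (1 - 2 * s) * log R ^ m`. -/
lemma exists_hasSum_clip_div_sq [Countable ι] (hv : ∀ t, {k | v k ≤ t}.Finite)
    (hv1 : ∀ k, 1 ≤ v k) {s C : ℝ} {m : ℕ} (hs : 1 / 2 < s)
    (h : Tendsto (fun t => count v t / (t * Real.log t ^ m)) atTop (𝓝 C)) :
    ∃ Q : ℝ → ℝ,
      (∀ᶠ R in atTop, HasSum (fun k => (clip (v k ^ s / R ^ s) / v k ^ s) ^ 2) (Q R)) ∧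
      Tendsto (fun R => Q R / (R ^ (1 - 2 * s) * Real.log R ^ m)) atTop
        (𝓝 (C * (2 * s) / (2 * s - 1) - C * (2 * s) / (2 * s + 1))) := by
  have hs0 : 0 < s := by linarith
  set f : ℝ → ℝ := fun t => count v t * (2 * s * t ^ (-(2 * s) - 1)) with hf
  have hfm : Measurable f := (count_monotone hv).measurable.mul (by fun_prop)
  obtain ⟨hint, hlim⟩ := tendsto_integral_Ioi_div_rpow_mul_log_pow (f := f) (α := 1 - 2 * s)
    (c := C * (2 * s)) (by linarith) m hfm ((h.mul_const (2 * s)).congr' (by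
      filter_upwards [eventually_gt_atTop 1] with t ht
      have hl := Real.log_pos ht
      have h0 : 0 < t := by positivity
      have h1 : t ^ (1 - 2 * s - 1) = t ^ (-(2 * s) - 1) * t := by
        rw [Real.rpow_sub_one h0.ne' (-(2 * s)), div_mul_cancel₀ _ h0.ne']
        congr 1
        ring
      rw [h1, hf]
      have : t ^ (-(2 * s) - 1) ≠ 0 := by positivity
      field_simp))
  rw [neg_sub] at hlim
  refine ⟨fun R => (∫ t in Set.Ioi R, f t) - R ^ (-(2 * s)) * cutSum hv s R, ?_, ?_⟩
  · filter_upwards [hint, eventually_gt_atTop 0] with R hR hR0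
    have h1 := (hasSum_max_rpow_neg hv (by positivity : 0 < 2 * s) hR0 hR).sub
      ((hasSum_cutSum hv hs0 hR0).mul_left (R ^ (-(2 * s))))
    refine h1.congr_fun fun k => ?_
    exact clip_div_sq_eq hs0 (zero_lt_one.trans_le (hv1 k)) hR0
  · refine (hlim.sub (tendsto_cutSum hv hv1 hs0 h)).congr' ?_
    filter_upwards [eventually_gt_atTop 1] with R hR
    have h0 : 0 < R := by positivity
    have hl := Real.log_pos hR
    have h1 : R ^ (1 - 2 * s) = R ^ (-(2 * s)) * R := by
      rw [← Real.rpow_add_one h0.ne']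
      congr 1
      ring
    rw [h1]
    have : R ^ (-(2 * s)) ≠ 0 := by positivity
    field_simp

end Sums

/-! ### Inversion of the asymptotic relations -/

/-- The threshold at which the counting function is about a constant multiple of `y * n`. -/
noncomputable def radius (m : ℕ) (y : ℝ) (n : ℕ) : ℝ := y * n / Real.log n ^ m

lemma eventually_log_pos : ∀ᶠ n : ℕ in atTop, 1 < (n : ℝ) ∧ 0 < Real.log n := by
  filter_upwards [eventually_gt_atTop 1] with n hn
  have : (1 : ℝ) < n := by exact_mod_cast hn
  exact ⟨this, Real.log_pos this⟩

lemma tendsto_radius_atTop (m : ℕ) {y : ℝ} (hy : 0 < y) :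
    Tendsto (radius m y) atTop atTop := by
  have h1 : Tendsto (fun t : ℝ => Real.log t ^ m / t) atTop (𝓝[>] 0) := by
    refine tendsto_nhdsWithin_iff.mpr ⟨?_, ?_⟩
    · have := tendsto_rpow_mul_log_pow_zero (α := -1) (by norm_num) m
      refine this.congr' ?_
      filter_upwards [eventually_gt_atTop 0] with t ht
      rw [Real.rpow_neg_one, mul_comm, div_eq_mul_inv]
    · filter_upwards [eventually_gt_atTop 1] with t ht
      have := Real.log_pos ht
      have : 0 < t := by positivity
      exact Set.mem_Ioi.mpr (by positivity)
  have h2 := (h1.inv_tendsto_nhdsGT_zero.const_mul_atTop hy).comp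
    (tendsto_natCast_atTop_atTop (R := ℝ))
  refine h2.congr fun n => ?_
  simp only [Function.comp_apply, Pi.inv_apply, inv_div, radius, mul_div_assoc]

lemma tendsto_log_radius_div_log (m : ℕ) {y : ℝ} (hy : 0 < y) :
    Tendsto (fun n : ℕ => Real.log (radius m y n) / Real.log n) atTop (𝓝 1) := by
  have hlog : Tendsto (fun n : ℕ => Real.log n) atTop atTop :=
    Real.tendsto_log_atTop.comp tendsto_natCast_atTop_atTop
  have h1 : Tendsto (fun n : ℕ => Real.log y / Real.log n) atTop (𝓝 0) :=
    tendsto_const_nhds.div_atTop hlog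
  have h2 : Tendsto (fun n : ℕ => Real.log (Real.log n) / Real.log n) atTop (𝓝 0) := by
    have := Real.isLittleO_log_id_atTop.tendsto_div_nhds_zero.comp hlog
    exact this
  have h3 : Tendsto (fun n : ℕ => Real.log y / Real.log n + 1
      - m * (Real.log (Real.log n) / Real.log n)) atTop (𝓝 1) := by
    simpa using (h1.add_const 1).sub (h2.const_mul (m : ℝ))
  refine h3.congr' ?_
  filter_upwards [eventually_log_pos] with n hn
  obtain ⟨hn, hl⟩ := hn
  have hn0 : (n : ℝ) ≠ 0 := by positivity
  rw [radius, Real.log_div (by positivity) (by positivity), Real.log_mul hy.ne' hn0, Real.log_pow]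
  field_simp

lemma tendsto_radius_mul_log_pow_div (m : ℕ) {y : ℝ} (hy : 0 < y) :
    Tendsto (fun n : ℕ => radius m y n * Real.log (radius m y n) ^ m / n) atTop (𝓝 y) := by
  have h := ((tendsto_log_radius_div_log m hy).pow m).const_mul y
  rw [one_pow, mul_one] at h
  refine h.congr' ?_
  filter_upwards [eventually_log_pos] with n hn
  obtain ⟨hn, hl⟩ := hn
  have hn0 : (n : ℝ) ≠ 0 := by positivity
  rw [div_pow]
  conv_rhs => rw [radius]
  field_simp
  rfl

lemma tendsto_comp_radius_div {P : ℝ → ℝ} {m : ℕ} {a y : ℝ} (hy : 0 < y)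
    (h : Tendsto (fun R => P R / (R * Real.log R ^ m)) atTop (𝓝 a)) :
    Tendsto (fun n : ℕ => P (radius m y n) / n) atTop (𝓝 (a * y)) := by
  have hR := tendsto_radius_atTop m hy
  refine ((h.comp hR).mul (tendsto_radius_mul_log_pow_div m hy)).congr' ?_
  filter_upwards [hR.eventually_gt_atTop 1] with n hn
  have := Real.log_pos hn
  have : 0 < radius m y n := by positivity
  simp only [Function.comp_apply]
  field_simp

lemma radius_rpow_neg_div {m n : ℕ} {y s : ℝ} (hy : 0 < y) (hn : 1 < (n : ℝ)) :
    radius m y n ^ (-s) / ((n : ℝ) ^ (-s) * Real.log n ^ (s * m)) = y ^ (-s) := by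
  have hl := Real.log_pos hn
  have hn0 : 0 < (n : ℝ) := by positivity
  rw [radius, Real.div_rpow (by positivity) (by positivity), Real.mul_rpow hy.le hn0.le,
    ← Real.rpow_natCast, ← Real.rpow_mul hl.le, mul_neg, Real.rpow_neg hl.le, mul_comm s]
  have h1 : (n : ℝ) ^ (-s) ≠ 0 := by positivity
  have h2 : Real.log n ^ (m * s) ≠ 0 := by positivity
  field_simp

/-- A sequence that is squeezed between comparison sequences for the parameters below and above
`y₀`, whose limits depend continuously on the parameter at `y₀`. -/
lemma tendsto_of_forall_compare {X : ℕ → ℝ} {U : ℝ → ℕ → ℝ} {l : ℝ → ℝ} {y₀ : ℝ} (hy₀ : 0 < y₀)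
    (hl : ContinuousAt l y₀) (hU : ∀ y, 0 < y → Tendsto (U y) atTop (𝓝 (l y)))
    (hup : ∀ y, 0 < y → y < y₀ → ∀ᶠ n in atTop, X n ≤ U y n)
    (hlow : ∀ y, y₀ < y → ∀ᶠ n in atTop, U y n ≤ X n) :
    Tendsto X atTop (𝓝 (l y₀)) := by
  refine tendsto_order.mpr ⟨fun b hb => ?_, fun b hb => ?_⟩
  · have h1 : ∀ᶠ y in 𝓝[>] y₀, b < l y := nhdsWithin_le_nhds (hl.eventually_const_lt hb)
    obtain ⟨y, hby, hy⟩ := (h1.and self_mem_nhdsWithin).exists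
    filter_upwards [hlow y hy, (hU y (hy₀.trans hy)).eventually_const_lt hby] with n h2 h3
    exact h3.trans_le h2
  · have h1 : ∀ᶠ y in 𝓝[<] y₀, l y < b := nhdsWithin_le_nhds (hl.eventually_lt_const hb)
    have h0 : ∀ᶠ y in 𝓝[<] y₀, 0 < y := nhdsWithin_le_nhds (lt_mem_nhds hy₀)
    obtain ⟨y, ⟨hby, hy0⟩, hy⟩ := ((h1.and h0).and self_mem_nhdsWithin).exists
    filter_upwards [hup y hy0 hy, (hU y hy0).eventually_lt_const hby] with n h2 h3
    exact h2.trans_lt h3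

/-! ### The asymptotic behaviour of the widths -/

section Widths

variable {d m : ℕ} {v : (Fin d → ℤ) → ℝ} {s C : ℝ}

lemma eventually_cutSum_radius_le (hv : ∀ t, {k | v k ≤ t}.Finite) (hv1 : ∀ k, 1 ≤ v k)
    (hs : 0 < s) (h : Tendsto (fun t => count v t / (t * Real.log t ^ m)) atTop (𝓝 C)) {y : ℝ}
    (hy : 0 < y) (hlt : C * (2 * s) / (2 * s + 1) * y < 1) :
    ∀ᶠ n : ℕ in atTop, cutSum hv s (radius m y n) ≤ n := by
  filter_upwards [(tendsto_comp_radius_div hy (tendsto_cutSum hv hv1 hs h)).eventually_lt_const hlt,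
    eventually_log_pos] with n h1 h2
  rw [div_lt_one (by linarith [h2.1])] at h1
  exact h1.le

lemma eventually_le_cutSum_radius (hv : ∀ t, {k | v k ≤ t}.Finite) (hv1 : ∀ k, 1 ≤ v k)
    (hs : 0 < s) (h : Tendsto (fun t => count v t / (t * Real.log t ^ m)) atTop (𝓝 C)) {y : ℝ}
    (hy : 0 < y) (hlt : 1 < C * (2 * s) / (2 * s + 1) * y) :
    ∀ᶠ n : ℕ in atTop, n ≤ cutSum hv s (radius m y n) := by
  filter_upwards [(tendsto_comp_radius_div hy (tendsto_cutSum hv hv1 hs h)).eventually_const_lt hlt,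
    eventually_log_pos] with n h1 h2
  rw [one_lt_div (by linarith [h2.1])] at h1
  exact h1.le

lemma sum_one_sub_clip_le (hv : ∀ t, {k | v k ≤ t}.Finite) (hs : 0 < s) {R : ℝ} (hR : 0 < R)
    (G : Finset (Fin d → ℤ)) :
    ∑ k ∈ G, (1 - clip (v k ^ s / R ^ s)) ≤ cutSum hv s R :=
  sum_le_hasSum G (fun _ _ => sub_nonneg.mpr (clip_le_one _)) (hasSum_cutSum hv hs hR)

lemma cutSum_one (hv : ∀ t, {k | v k ≤ t}.Finite) (hv1 : ∀ k, 1 ≤ v k) (hs : 0 < s) :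
    cutSum hv s 1 = 0 :=
  Finset.sum_eq_zero fun k _ => by rw [clip_of_ge hs one_pos (hv1 k), sub_self]

lemma l2_width_lt_top (hd : 1 ≤ d) (hv : ∀ t, {k | v k ≤ t}.Finite) (hv1 : ∀ k, 1 ≤ v k)
    (hs : 0 < s) (n : ℕ) :
    nTermWidth (weightedNorm (fun k => v k ^ s) 2) (weightedNorm (fun _ => 1) 2) (trigSystem d) n
      < ∞ := by
  refine (l2_width_le (T := 1 ^ s) hd (fun k => Real.one_le_rpow (hv1 k) hs.le) (by positivity) n
    fun G => ?_).trans_lt ENNReal.ofReal_lt_top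
  refine (sum_one_sub_clip_le hv hs one_pos G).trans ?_
  rw [cutSum_one hv hv1 hs]
  positivity

lemma wiener_width_lt_top (hd : 1 ≤ d) (hv : ∀ t, {k | v k ≤ t}.Finite) (hv1 : ∀ k, 1 ≤ v k)
    (hs : 1 / 2 < s) (h : Tendsto (fun t => count v t / (t * Real.log t ^ m)) atTop (𝓝 C))
    (n : ℕ) :
    nTermWidth (weightedNorm (fun k => v k ^ s) 2) (weightedNorm (fun _ => 1) 1) (trigSystem d) n
      < ∞ := by
  have hs0 : 0 < s := by linarith
  obtain ⟨Q, hQ, -⟩ := exists_hasSum_clip_div_sq hv hv1 hs h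
  obtain ⟨R, hQR, hR⟩ := (hQ.and (eventually_ge_atTop 1)).exists
  have hR0 : 0 < R := zero_lt_one.trans_le hR
  have hT : 1 ≤ R ^ s := Real.one_le_rpow hR hs0.le
  have hω : ∀ k, 1 ≤ v k ^ s := fun k => Real.one_le_rpow (hv1 k) hs0.le
  refine (wiener_width_le (T := 1 ^ s) (q := (R ^ s) ^ 4 * Q R) hd hω n
    (fun G => ?_) fun G => ?_).trans_lt ENNReal.ofReal_lt_top
  · refine (sum_one_sub_clip_le hv hs0 one_pos G).trans ?_
    rw [cutSum_one hv hv1 hs0]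
    positivity
  · have hsum : ∑ k ∈ G, (clip (v k ^ s / R ^ s) / v k ^ s) ^ 2 ≤ Q R :=
      sum_le_hasSum G (fun _ _ => sq_nonneg _) hQR
    refine le_trans ?_ (mul_le_mul_of_nonneg_left hsum (by positivity))
    rw [Finset.mul_sum]
    refine Finset.sum_le_sum fun k _ => ?_
    have hωk : 0 < v k ^ s := zero_lt_one.trans_le (hω k)
    -- the cut at height `1` exceeds the cut at height `R` by a bounded factor
    have h1 : clip (v k ^ s / 1 ^ s) ≤ (R ^ s) ^ 2 * clip (v k ^ s / R ^ s) := by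
      refine (clip_le_one _).trans ?_
      rcases clip_eq_one_or (v k ^ s / R ^ s) with h2 | h2
      · rw [h2, mul_one]
        exact one_le_pow₀ hT
      · rw [h2, ← mul_pow, mul_div_cancel₀ _ (by positivity)]
        exact one_le_pow₀ (hω k)
    have h2 : (R ^ s) ^ 4 * (clip (v k ^ s / R ^ s) / v k ^ s) ^ 2
        = ((R ^ s) ^ 2 * clip (v k ^ s / R ^ s) / v k ^ s) ^ 2 := by ring
    rw [h2]
    have := clip_nonneg (v k ^ s / 1 ^ s)
    gcongr

/-- The asymptotic behaviour of the widths in `L₂`. -/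
lemma tendsto_l2_width (hd : 1 ≤ d) (hv : ∀ t, {k | v k ≤ t}.Finite) (hv1 : ∀ k, 1 ≤ v k)
    (hs : 0 < s) (hC : 0 < C)
    (h : Tendsto (fun t => count v t / (t * Real.log t ^ m)) atTop (𝓝 C)) :
    Tendsto (fun n : ℕ => (nTermWidth (weightedNorm (fun k => v k ^ s) 2)
        (weightedNorm (fun _ => 1) 2) (trigSystem d) n).toReal
        / ((n : ℝ) ^ (-s) * Real.log n ^ (s * m)))
      atTop (𝓝 ((C * (2 * s) / (2 * s + 1)) ^ s)) := by
  set a := C * (2 * s) / (2 * s + 1) with ha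
  have ha0 : 0 < a := by positivity
  have hω : ∀ k, 1 ≤ v k ^ s := fun k => Real.one_le_rpow (hv1 k) hs.le
  have hval : a ^ s = (a⁻¹) ^ (-s) := by
    rw [Real.inv_rpow ha0.le, Real.rpow_neg ha0.le, inv_inv]
  rw [hval]
  refine tendsto_of_forall_compare (U := fun y _ => y ^ (-s)) (l := fun y => y ^ (-s))
    (inv_pos.mpr ha0) (Real.continuousAt_rpow_const _ _ (Or.inl (inv_pos.mpr ha0).ne'))
    (fun y _ => tendsto_const_nhds) (fun y hy hya => ?_) fun y hya => ?_
  · have hlt : a * y < 1 := by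
      rwa [← lt_inv_mul_iff₀ ha0, mul_one]
    filter_upwards [eventually_cutSum_radius_le hv hv1 hs h hy hlt, eventually_log_pos,
      (tendsto_radius_atTop m hy).eventually_gt_atTop 0] with n hcut ⟨hn, hl⟩ hR
    rw [← radius_rpow_neg_div (m := m) hy hn]
    gcongr
    refine ENNReal.toReal_le_of_le_ofReal (by positivity) ?_
    rw [Real.rpow_neg hR.le, ← one_div]
    exact l2_width_le hd hω (by positivity) n fun G =>
      (sum_one_sub_clip_le hv hs hR G).trans hcut
  · have hy : 0 < y := (inv_pos.mpr ha0).trans hya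
    have hlt : 1 < a * y := by
      rwa [← inv_mul_lt_iff₀ ha0, mul_one]
    filter_upwards [eventually_le_cutSum_radius hv hv1 hs h hy hlt, eventually_log_pos,
      (tendsto_radius_atTop m hy).eventually_gt_atTop 0, eventually_gt_atTop 0]
      with n hcut ⟨hn, hl⟩ hR hn0
    rw [← radius_rpow_neg_div (m := m) hy hn]
    gcongr
    rw [← ENNReal.ofReal_le_iff_le_toReal (l2_width_lt_top hd hv hv1 hs n).ne,
      Real.rpow_neg hR.le, ← one_div]
    exact le_l2_width hω (by positivity) hn0 _ hcut

/-- The asymptotic behaviour of the widths in the Wiener algebra. -/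
lemma tendsto_wiener_width (hd : 1 ≤ d) (hv : ∀ t, {k | v k ≤ t}.Finite) (hv1 : ∀ k, 1 ≤ v k)
    (hs : 1 / 2 < s) (hC : 0 < C)
    (h : Tendsto (fun t => count v t / (t * Real.log t ^ m)) atTop (𝓝 C)) :
    Tendsto (fun n : ℕ => (nTermWidth (weightedNorm (fun k => v k ^ s) 2)
        (weightedNorm (fun _ => 1) 1) (trigSystem d) n).toReal
        / ((n : ℝ) ^ (-s + 1 / 2) * Real.log n ^ (s * m)))
      atTop (𝓝 ((C * (2 * s) / (2 * s + 1)) ^ s * (1 / (s - 1 / 2)) ^ (1 / 2 : ℝ))) := by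
  have hs0 : 0 < s := by linarith
  have hs1 : 0 < s - 1 / 2 := by linarith
  set a := C * (2 * s) / (2 * s + 1) with ha
  have ha0 : 0 < a := by positivity
  have hω : ∀ k, 1 ≤ v k ^ s := fun k => Real.one_le_rpow (hv1 k) hs0.le
  obtain ⟨Q, hQ, hQlim⟩ := exists_hasSum_clip_div_sq hv hv1 hs h
  have hb : C * (2 * s) / (2 * s - 1) - C * (2 * s) / (2 * s + 1) = a / (s - 1 / 2) := by
    have h1 : 2 * s - 1 ≠ 0 := by linarith
    have h2 : s - 1 / 2 ≠ 0 := hs1.ne'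
    rw [ha, div_sub_div _ _ h1 (by positivity), div_div, div_eq_div_iff (by positivity)
      (by positivity)]
    ring
  rw [hb] at hQlim
  set l : ℝ → ℝ := fun y => y ^ (-s) * √(a / (s - 1 / 2) * y) with hl
  have hval : a ^ s * (1 / (s - 1 / 2)) ^ (1 / 2 : ℝ) = l a⁻¹ := by
    simp only [hl]
    rw [Real.inv_rpow ha0.le, Real.rpow_neg ha0.le, inv_inv, ← Real.sqrt_eq_rpow]
    congr 2
    field_simp
  rw [hval]
  have hU : ∀ y, 0 < y → Tendsto (fun n : ℕ => √(Q (radius m y n))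
      / ((n : ℝ) ^ (-s + 1 / 2) * Real.log n ^ (s * m))) atTop (𝓝 (l y)) := by
    intro y hy
    have hR := tendsto_radius_atTop m hy
    have h1 : Tendsto (fun R => Q R / R ^ (-(2 * s)) / (R * Real.log R ^ m)) atTop
        (𝓝 (a / (s - 1 / 2))) := by
      refine hQlim.congr' ?_
      filter_upwards [eventually_gt_atTop 0] with R hR
      rw [div_div, ← mul_assoc, ← Real.rpow_add_one hR.ne']
      congr 3
      ring
    have h2 := (tendsto_comp_radius_div hy h1).sqrt.const_mul (y ^ (-s))
    refine h2.congr' ?_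
    filter_upwards [eventually_log_pos, hR.eventually_gt_atTop 0] with n ⟨hn, hlog⟩ hR0
    have hn0 : 0 < (n : ℝ) := by positivity
    have hsq : radius m y n ^ (-(2 * s)) = (radius m y n ^ (-s)) ^ 2 := by
      rw [← Real.rpow_natCast, ← Real.rpow_mul hR0.le]
      congr 1
      push_cast
      ring
    rw [hsq, div_div, mul_comm _ (n : ℝ), Real.sqrt_div' _ (by positivity),
      Real.sqrt_mul hn0.le, Real.sqrt_sq (by positivity), ← radius_rpow_neg_div (m := m) hy hn,
      Real.rpow_add hn0, ← Real.sqrt_eq_rpow]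
    have h3 : radius m y n ^ (-s) ≠ 0 := by positivity
    have h4 : (n : ℝ) ^ (-s) ≠ 0 := by positivity
    have h5 : Real.log n ^ (s * m) ≠ 0 := by positivity
    have h6 : √(n : ℝ) ≠ 0 := by positivity
    field_simp
  refine tendsto_of_forall_compare (inv_pos.mpr ha0) ?_ hU (fun y hy hya => ?_) fun y hya => ?_
  · have h1 : ContinuousAt (fun y : ℝ => y ^ (-s)) a⁻¹ :=
      Real.continuousAt_rpow_const _ _ (Or.inl (inv_pos.mpr ha0).ne')
    exact h1.mul (by fun_prop)
  · have hlt : a * y < 1 := by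
      rwa [← lt_inv_mul_iff₀ ha0, mul_one]
    have hR := tendsto_radius_atTop m hy
    filter_upwards [eventually_cutSum_radius_le hv hv1 hs0 h hy hlt, eventually_log_pos,
      hR.eventually_gt_atTop 0, hR.eventually hQ] with n hcut ⟨hn, hl⟩ hR hQn
    gcongr
    refine ENNReal.toReal_le_of_le_ofReal (by positivity) ?_
    exact wiener_width_le hd hω n
      (fun G => (sum_one_sub_clip_le hv hs0 hR G).trans hcut)
      fun G => sum_le_hasSum G (fun _ _ => sq_nonneg _) hQn
  · have hy : 0 < y := (inv_pos.mpr ha0).trans hya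
    have hlt : 1 < a * y := by
      rwa [← inv_mul_lt_iff₀ ha0, mul_one]
    have hR := tendsto_radius_atTop m hy
    filter_upwards [eventually_le_cutSum_radius hv hv1 hs0 h hy hlt, eventually_log_pos,
      hR.eventually_gt_atTop 0, hR.eventually hQ, eventually_gt_atTop 0]
      with n hcut ⟨hn, hl⟩ hR hQn hn0
    gcongr
    -- the lower bounds belonging to finite sets increase to the full sum
    refine le_of_tendsto ((Real.continuous_sqrt.tendsto _).comp hQn) ?_
    filter_upwards [eventually_ge_atTop (hv (radius m y n)).toFinset] with F hF
    rw [Function.comp_apply,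
      ← ENNReal.ofReal_le_iff_le_toReal (wiener_width_lt_top hd hv hv1 hs h n).ne]
    refine le_wiener_width hω (by positivity) hn0 F (hcut.trans ?_)
    exact Finset.sum_le_sum_of_subset_of_nonneg hF fun _ _ _ => sub_nonneg.mpr (clip_le_one _)

end Widths

/-! ### The weights of mixed smoothness -/

lemma finite_le_of_abs_le_iff {w : ℤ → ℝ} {x : ℝ → ℝ}
    (hx : ∀ R, 1 ≤ R → ∀ k : ℤ, w k ≤ R ↔ |(k : ℝ)| ≤ x R) (t : ℝ) : {k | w k ≤ t}.Finite := by
  refine (Set.finite_Icc (-⌊x (max t 1)⌋) ⌊x (max t 1)⌋).subset fun k (hk : w k ≤ t) => ?_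
  have h := (hx _ (le_max_right t 1) k).mp (hk.trans (le_max_left t 1))
  rwa [Set.mem_Icc, ← abs_le, Int.le_floor, Int.cast_abs]

/-- The weight of mixed smoothness is the `s`-th power of a product of one-dimensional weights,
which have about `2 * t` values below `t`. -/
lemma exists_mixWeight_eq {r : ℝ≥0∞} (hr : 0 < r) :
    ∃ w : ℤ → ℝ, (∀ k, 1 ≤ w k) ∧ (∀ t, {k | w k ≤ t}.Finite) ∧
      Tendsto (fun t => count w t / t) atTop (𝓝 2) ∧
      ∀ (d : ℕ) (s : ℝ), mixWeight (d := d) s r = fun k => (∏ i, w (k i)) ^ s := by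
  by_cases hr' : r = ∞
  · have hx : ∀ R : ℝ, 1 ≤ R → ∀ k : ℤ, max 1 |(k : ℝ)| ≤ R ↔ |(k : ℝ)| ≤ R := fun R hR k => by
      simp [hR]
    refine ⟨fun k => max 1 |(k : ℝ)|, fun k => le_max_left _ _, finite_le_of_abs_le_iff hx,
      tendsto_count_div_of_abs_le_iff hx (fun R hR => zero_le_one.trans hR) ?_, fun d s => ?_⟩
    · refine tendsto_const_nhds.congr' ?_
      filter_upwards [eventually_gt_atTop 0] with R hR
      rw [div_self hR.ne']
    · ext k
      rw [mixWeight, if_pos hr', Real.finsetProd_rpow]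
      exact fun i _ => zero_le_one.trans (le_max_left _ _)
  · set ρ := r.toReal with hρ
    have hρ0 : 0 < ρ := ENNReal.toReal_pos hr.ne' hr'
    have hx : ∀ R : ℝ, 1 ≤ R → ∀ k : ℤ,
        (1 + |(k : ℝ)| ^ ρ) ^ ρ⁻¹ ≤ R ↔ |(k : ℝ)| ≤ (R ^ ρ - 1) ^ ρ⁻¹ := by
      intro R hR k
      have h1 : 1 ≤ R ^ ρ := Real.one_le_rpow hR hρ0.le
      rw [Real.rpow_inv_le_iff_of_pos (by positivity) (by linarith) hρ0,
        Real.le_rpow_inv_iff_of_pos (by positivity) (by linarith) hρ0, le_sub_iff_add_le']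
    have hx0 : ∀ R : ℝ, 1 ≤ R → 0 ≤ (R ^ ρ - 1) ^ ρ⁻¹ := fun R hR =>
      Real.rpow_nonneg (sub_nonneg.mpr (Real.one_le_rpow hR hρ0.le)) _
    refine ⟨fun k => (1 + |(k : ℝ)| ^ ρ) ^ ρ⁻¹, fun k => ?_, finite_le_of_abs_le_iff hx,
      tendsto_count_div_of_abs_le_iff hx hx0 ?_, fun d s => ?_⟩
    · refine Real.one_le_rpow ?_ (by positivity)
      have : 0 ≤ |(k : ℝ)| ^ ρ := by positivity
      linarith
    · have h1 : Tendsto (fun R : ℝ => (1 - R ^ (-ρ)) ^ ρ⁻¹) atTop (𝓝 1) := by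
        have h2 := ((tendsto_rpow_neg_atTop hρ0).const_sub 1).rpow_const (p := ρ⁻¹)
          (Or.inl (by norm_num))
        simpa using h2
      refine h1.congr' ?_
      filter_upwards [eventually_gt_atTop 1] with R hR
      have hR0 : 0 < R := by positivity
      have h2 : 1 ≤ R ^ ρ := Real.one_le_rpow hR.le hρ0.le
      have h3 : R = (R ^ ρ) ^ ρ⁻¹ := by
        rw [← Real.rpow_mul hR0.le, mul_inv_cancel₀ hρ0.ne', Real.rpow_one]
      have h4 : 1 - R ^ (-ρ) = (R ^ ρ - 1) / R ^ ρ := by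
        rw [Real.rpow_neg hR0.le]
        field_simp
      rw [h4, Real.div_rpow (by linarith) (by positivity), ← h3]
    · ext k
      rw [mixWeight, if_neg hr', ← Real.finsetProd_rpow]
      · refine Finset.prod_congr rfl fun i _ => ?_
        rw [← Real.rpow_mul (by positivity)]
        congr 1
        rw [← hρ]
        ring
      · exact fun i _ => by positivity

end TrigWidth

theorem theorem4p2 (d : ℕ) (hd : 1 ≤ d) (s : ℝ) (hs : 0 < s) (r : ℝ≥0∞) (hr : 0 < r) :
    ((∀ n : ℕ, TrigWidth.nTermWidth (TrigWidth.sobolevMixNorm s r) TrigWidth.l2Norm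
          (TrigWidth.trigSystem d) n < ∞) ∧
      Tendsto
        (fun n : ℕ =>
          (TrigWidth.nTermWidth (TrigWidth.sobolevMixNorm s r) TrigWidth.l2Norm
            (TrigWidth.trigSystem d) n).toReal /
            ((n : ℝ) ^ (-s) * Real.log n ^ (s * ((d : ℝ) - 1))))
        atTop
        (𝓝 (s ^ s / (s + 1 / 2) ^ s * ((2 : ℝ) ^ d / ((d - 1)! : ℝ)) ^ s))) ∧
    (1 / 2 < s →
      (∀ n : ℕ, TrigWidth.nTermWidth (TrigWidth.sobolevMixNorm s r) TrigWidth.wienerNorm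
          (TrigWidth.trigSystem d) n < ∞) ∧
      Tendsto
        (fun n : ℕ =>
          (TrigWidth.nTermWidth (TrigWidth.sobolevMixNorm s r) TrigWidth.wienerNorm
            (TrigWidth.trigSystem d) n).toReal /
            ((n : ℝ) ^ (-s + 1 / 2) * Real.log n ^ (s * ((d : ℝ) - 1))))
        atTop
        (𝓝 ((s / (s + 1 / 2)) ^ s * (1 / (s - 1 / 2)) ^ (1 / 2 : ℝ) *
          ((2 : ℝ) ^ d / ((d - 1)! : ℝ)) ^ s))) := by

  obtain ⟨m, rfl⟩ : ∃ m, d = m + 1 := ⟨d - 1, by lia⟩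
  obtain ⟨w, hw1, hw, hwlim, hmix⟩ := TrigWidth.exists_mixWeight_eq hr
  obtain ⟨hv, hcount⟩ := TrigWidth.tendsto_count_prod_fin hw hw1 hwlim m
  have hv1 : ∀ k : Fin (m + 1) → ℤ, 1 ≤ ∏ i, w (k i) := fun k =>
    Finset.one_le_prod fun i _ => hw1 (k i)
  have hX : TrigWidth.sobolevMixNorm (d := m + 1) s r
      = TrigWidth.weightedNorm (fun k => (∏ i, w (k i)) ^ s) 2 := by
    ext f
    rw [TrigWidth.sobolevMixNorm, hmix]
  have hY : TrigWidth.l2Norm (d := m + 1) = TrigWidth.weightedNorm (fun _ => 1) 2 :=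
    funext TrigWidth.l2Norm_eq_weightedNorm
  have hA : TrigWidth.wienerNorm (d := m + 1) = TrigWidth.weightedNorm (fun _ => 1) 1 := rfl
  have hC : (0 : ℝ) < 2 ^ (m + 1) / (m ! : ℝ) := by positivity
  have hexp : ((m + 1 : ℕ) : ℝ) - 1 = m := by push_cast; ring
  have ha : (2 ^ (m + 1) / (m ! : ℝ) * (2 * s) / (2 * s + 1)) ^ s
      = (s / (s + 1 / 2)) ^ s * ((2 : ℝ) ^ (m + 1) / (m ! : ℝ)) ^ s := by
    rw [← Real.mul_rpow (by positivity) hC.le]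
    congr 1
    field_simp
  rw [hX, hY, hA, hexp, Nat.add_sub_cancel]
  refine ⟨⟨TrigWidth.l2_width_lt_top hd hv hv1 hs, ?_⟩, fun hs2 =>
    ⟨TrigWidth.wiener_width_lt_top hd hv hv1 hs2 hcount, ?_⟩⟩
  · have h := TrigWidth.tendsto_l2_width hd hv hv1 hs hC hcount
    rwa [ha, Real.div_rpow hs.le (by positivity)] at h
  · have h := TrigWidth.tendsto_wiener_width hd hv hv1 hs2 hC hcount
    rwa [ha, mul_right_comm] at h
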